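/- Let $n\ge 1$ and let $M$ be a compact smooth $n$-dimensional manifold, possibly with boundary. Let $\pi:T^*M\to M$ be its cotangent bundle, $\alpha$ the canonical 1-form on $T^*M$ ($\alpha_p(v)=p(\pi_*v)$), $\omega=d\alpha$, and $\Omega=\alpha\wedge(d\alpha)^{n-1}/n!$. A star Hamiltonian is a continuous proper function $H:T^*M\to[0,\infty)$ that is positive outside the zero section and satisfies $H(tp)=tH(p)$ for $t>0$; a star body is a set of the form $A=\{p\in T^*M: H(p)\le 1\}$ for a (necessarily unique) star Hamiltonian $H$, and $V(A)=\int_A\omega^n/n!$ is its symplectic volume. Fix a model star body $U=\{H_0\le 1\}$ whose star Hamiltonian $H_0$ is smooth outside the zero section, and let $\partial U=\{H_0=1\}$, oriented as the boundary of $U$ (with $T^*M$ oriented by $\omega^n$). The radial function $\rho_A$ of a star body $A=\{H\le1\}$ is the restriction of $1/H$ to $\partial U$. For star bodies $A_1,\dots,A_n$ in $T^*M$ with radial functions $\rho_1,\dots,\rho_n$, the dual mixed volume is $$\tilde V(A_1,\dots,A_n)=\int_{\partial U}\rho_1\cdots\rho_n\,\Omega .$$ **Theorem (Main inequality).** For all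 star bodies $A_1,\dots,A_n$ in $T^*M$, $$\tilde V(A_1,\dots,A_n)^n\le V(A_1)\cdots V(A_n),$$ and equality holds if and only if all the $A_i$ are dilations of each other, i.e. for all $i,j$ there is $t>0$ with $A_i=tA_j:=\{tp: p\in A_j\}$. -/

import Mathlib

open Set MeasureTheory Bundle
open scoped Manifold ContDiff BigOperators Topology

noncomputable section

namespace StarGeom

/-! ### Differential forms on a vector space, given by their values on tuples of vectors -/

section Forms

variable {Z : Type*}

/-- The wedge product of a `k`-form `a` and an `l`-form `b`:
`(a ∧ b)(v) = (k! l!)⁻¹ ∑_σ sgn(σ) a(v_{σ(1)}, …, v_{σ(k)}) b(v_{σ(k+1)}, …, v_{σ(k+l)})`. -/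
def wedge {k l : ℕ} (a : (Fin k → Z) → ℝ) (b : (Fin l → Z) → ℝ) : (Fin (k + l) → Z) → ℝ :=
  fun v => ((k.factorial : ℝ) * (l.factorial : ℝ))⁻¹ *
    ∑ σ : Equiv.Perm (Fin (k + l)), ((Equiv.Perm.sign σ : ℤ) : ℝ) *
      a (fun i => v (σ (Fin.castAdd l i))) * b (fun j => v (σ (Fin.natAdd k j)))

/-- The `k`-th exterior power `a ∧ ⋯ ∧ a` of a 2-form `a`. -/
def wedgePow (a : (Fin 2 → Z) → ℝ) : (k : ℕ) → (Fin (2 * k) → Z) → ℝ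
  | 0 => fun _ => 1
  | k + 1 => wedge (wedgePow a k) a

end Forms

/-! ### The cotangent bundle, its canonical coordinates and its canonical form -/

section Cotangent

/-- The vector space `ℝⁿ`, with its Euclidean norm. -/
abbrev Vec (n : ℕ) : Type := EuclideanSpace ℝ (Fin n)

variable {n : ℕ} {H : Type*} [TopologicalSpace H] (I : ModelWithCorners ℝ (Vec n) H)
  (M : Type*) [TopologicalSpace M] [ChartedSpace H M] [IsManifold I ∞ M]

/-- The cotangent bundle `T*M`; a point is a pair `⟨x, p⟩` with `p : T_x M →L[ℝ] ℝ`. Its topology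
and its atlas are those of the bundle of linear maps from `TM` to the trivial line bundle. -/
abbrev CotangentBundle : Type _ :=
  TotalSpace (Vec n →L[ℝ] ℝ) (fun x : M => TangentSpace I x →L[ℝ] Bundle.Trivial M ℝ x)

/-- The model with corners of the cotangent bundle. -/
abbrev cotangentModel : ModelWithCorners ℝ (Vec n × (Vec n →L[ℝ] ℝ))
    (ModelProd H (Vec n →L[ℝ] ℝ)) :=
  I.prod 𝓘(ℝ, Vec n →L[ℝ] ℝ)

variable {M}

/-- The covector `t p`, for a number `t`. -/
def scale (t : ℝ) (p : CotangentBundle I M) : CotangentBundle I M :=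
  ⟨p.proj, t • p.snd⟩

/-- The canonical 1-form `α` on `T*M`: `α_p(v) = p(π_* v)`. -/
def canonicalForm (p : CotangentBundle I M) :
    TangentSpace (cotangentModel I) p →L[ℝ] ℝ :=
  ContinuousLinearMap.comp (p.snd : TangentSpace I p.proj →L[ℝ] ℝ)
    (mfderiv (cotangentModel I) I (fun q : CotangentBundle I M => q.proj) p)

/-- The inverse of the canonical coordinates `(q, p) = (q₁,…,qₙ,p₁,…,pₙ)` of `T*M` that belong to
the preferred chart `q` of `M` at `x`: it sends `(q, p)` to the covector `∑ pᵢ dqᵢ` at the point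
with coordinates `q`. -/
def coord (x : M) (z : Vec n × Vec n) : CotangentBundle I M :=
  (extChartAt (cotangentModel I) (⟨x, 0⟩ : CotangentBundle I M)).symm (z.1, innerSL ℝ z.2)

/-- The range of canonical coordinates `(q, p)` (all of `ℝⁿ × ℝⁿ` if `M` has no boundary). -/
def coordRange : Set (Vec n × Vec n) := range I ×ˢ univ

/-- The canonical 1-form in canonical coordinates, i.e. its pull-back under `coord I x`. -/
def localCanonicalForm (x : M) (z : Vec n × Vec n) : (Vec n × Vec n) [⋀^Fin 1]→L[ℝ] ℝ :=
  ContinuousAlternatingMap.ofSubsingleton ℝ (Vec n × Vec n) ℝ 0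
    (ContinuousLinearMap.comp (canonicalForm I (coord I x z))
      (mfderivWithin 𝓘(ℝ, Vec n × Vec n) (cotangentModel I) (coord I x) (coordRange I) z))

/-- The symplectic form `ω = dα` in canonical coordinates. -/
def localSymplecticForm (x : M) (z : Vec n × Vec n) : (Vec n × Vec n) [⋀^Fin 2]→L[ℝ] ℝ :=
  extDerivWithin (localCanonicalForm I x) (coordRange I) z

/-- The Liouville volume form `ωⁿ / n!` in canonical coordinates. -/
def localVolumeForm (x : M) (z : Vec n × Vec n) : (Fin (2 * n) → Vec n × Vec n) → ℝ :=
  fun v => (n.factorial : ℝ)⁻¹ * wedgePow (localSymplecticForm I x z) n v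

/-- The `(2n-1)`-form `Ω = α ∧ (dα)ⁿ⁻¹ / n!` in canonical coordinates. -/
def localOmega (x : M) (z : Vec n × Vec n) : (Fin (1 + 2 * (n - 1)) → Vec n × Vec n) → ℝ :=
  fun v => (n.factorial : ℝ)⁻¹ *
    wedge (localCanonicalForm I x z) (wedgePow (localSymplecticForm I x z) (n - 1)) v

/-- The frame `∂/∂p₁, ∂/∂q₁, ∂/∂p₂, ∂/∂q₂, …, ∂/∂pₙ, ∂/∂qₙ` (numbered from `0`), which is
orthonormal in coordinates and positively oriented for `ωⁿ`, where `ω = ∑ dpᵢ ∧ dqᵢ`. -/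
def canonicalFrame (n k : ℕ) : Vec n × Vec n :=
  let e : Vec n := WithLp.toLp 2 (fun i : Fin n => if i.val = k / 2 then 1 else 0)
  if k % 2 = 0 then (0, e) else (e, 0)

end Cotangent

/-! ### Star Hamiltonians and star bodies -/

section StarBodies

variable {n : ℕ} {H : Type*} [TopologicalSpace H] (I : ModelWithCorners ℝ (Vec n) H)
  (M : Type*) [TopologicalSpace M] [ChartedSpace H M] [IsManifold I ∞ M]

/-- Star Hamiltonians on `T*M`. -/
structure StarHamiltonian where
  /-- The underlying function. -/
  toFun : CotangentBundle I M → ℝ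
  nonneg : ∀ p, 0 ≤ toFun p
  continuous : Continuous toFun
  pos : ∀ p, p.snd ≠ 0 → 0 < toFun p
  homogeneous : ∀ (t : ℝ) (p : CotangentBundle I M), 0 < t → toFun (scale I t p) = t * toFun p
  proper : IsProperMap toFun

variable {M}

/-- A star Hamiltonian is smooth if it is smooth outside the zero section. -/
def StarHamiltonian.IsSmooth (h : StarHamiltonian I M) : Prop :=
  ContMDiffOn (cotangentModel I) 𝓘(ℝ, ℝ) ∞ h.toFun {p | p.snd ≠ 0}

variable (M)

/-- Star bodies in `T*M`: the subsets of the form `{H ≤ 1}` for a star Hamiltonian `H`. -/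
structure StarBody where
  /-- The underlying set. -/
  carrier : Set (CotangentBundle I M)
  exists_hamiltonian : ∃ h : StarHamiltonian I M, carrier = {p | h.toFun p ≤ 1}

variable {M}

/-- A star Hamiltonian is determined by its star body. -/
theorem StarHamiltonian.toFun_eq_of_sublevel_eq (h k : StarHamiltonian I M)
    (e : {p | h.toFun p ≤ 1} = {p | k.toFun p ≤ 1}) : h.toFun = k.toFun := by
  have key : ∀ (h k : StarHamiltonian I M), {p | h.toFun p ≤ 1} = {p | k.toFun p ≤ 1} →
      ∀ p, k.toFun p ≤ h.toFun p := by
    intro h k e p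
    refine le_of_forall_pos_le_add fun ε hε => ?_
    have ht : 0 < h.toFun p + ε := add_pos_of_nonneg_of_pos (h.nonneg p) hε
    have h1 : scale I (h.toFun p + ε)⁻¹ p ∈ {p | h.toFun p ≤ 1} := by
      simp only [mem_ofPred_eq, h.homogeneous _ p (inv_pos.2 ht)]
      rw [inv_mul_le_iff₀ ht]
      linarith
    rw [e] at h1
    simp only [mem_ofPred_eq, k.homogeneous _ p (inv_pos.2 ht)] at h1
    rw [inv_mul_le_iff₀ ht] at h1
    linarith
  funext p
  exact le_antisymm (key k h e.symm p) (key h k e p)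

/-- The Hamiltonian of a star body `A`: the unique star Hamiltonian `H` with `A = {H ≤ 1}`. -/
def StarBody.hamiltonian (A : StarBody I M) : StarHamiltonian I M :=
  A.exists_hamiltonian.choose

theorem StarBody.carrier_eq (A : StarBody I M) :
    A.carrier = {p | (A.hamiltonian I).toFun p ≤ 1} :=
  A.exists_hamiltonian.choose_spec

/-- The formula `1/H` for the radial function of the star body `A = {H ≤ 1}`. The radial function
of `A` with respect to a model body `U` is its restriction to the boundary of `U`. -/
def StarBody.radial (A : StarBody I M) (p : CotangentBundle I M) : ℝ :=
  1 / (A.hamiltonian I).toFun p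

/-- The dilation `t A` of a subset of `T*M`. -/
def dilate (t : ℝ) (A : Set (CotangentBundle I M)) : Set (CotangentBundle I M) :=
  scale I t '' A

end StarBodies

/-! ### Integration of forms, volume and dual mixed volume -/

section Volume

variable {n : ℕ} {H : Type*} [TopologicalSpace H] (I : ModelWithCorners ℝ (Vec n) H)
  {M : Type*} [TopologicalSpace M] [ChartedSpace H M] [IsManifold I ∞ M]

/-- A smooth partition of unity on `M` subordinate to the domains of the preferred charts. -/
def chartPartition (M : Type*) [TopologicalSpace M] [ChartedSpace H M] [IsManifold I ∞ M]
    [T2Space M] [CompactSpace M] : SmoothPartitionOfUnity M I M univ :=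
  (SmoothPartitionOfUnity.exists_isSubordinate_chartAt_source I M).choose

/-- The integral `∫_{T*M} f ωⁿ/n!`, through a partition of unity and canonical coordinates. -/
def liouvilleIntegral [T2Space M] [CompactSpace M] (f : CotangentBundle I M → ℝ) : ℝ :=
  ∑ᶠ x : M, ∫ z in (extChartAt I x).target ×ˢ (univ : Set (Vec n)),
    chartPartition I M x (coord I x z).proj * f (coord I x z) *
      localVolumeForm I x z (fun k => canonicalFrame n k)

/-- The symplectic volume `V(A) = ∫_A ωⁿ/n!`. -/
def symplecticVolume [T2Space M] [CompactSpace M] (A : Set (CotangentBundle I M)) : ℝ :=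
  liouvilleIntegral I (A.indicator fun _ => 1)

/-- The parametrization `(q, θ) ↦ (q, θ / H₀(q, θ))`, in canonical coordinates, of the boundary
`{H₀ = 1}` of a star body by points `q` of `M` and points `θ` of the unit sphere. It is written
as a map of all pairs `(q, p)`, `p ≠ 0`. -/
def boundaryParam (h₀ : StarHamiltonian I M) (x : M) (z : Vec n × Vec n) : Vec n × Vec n :=
  (z.1, (h₀.toFun (coord I x z))⁻¹ • z.2)

/-- The pull-back of the form `Ω` under `boundaryParam`. -/
def pulledOmega (h₀ : StarHamiltonian I M) (x : M) (z : Vec n × Vec n) :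
    (Fin (1 + 2 * (n - 1)) → Vec n × Vec n) → ℝ :=
  fun v => localOmega I x (boundaryParam I h₀ x z)
    (fun k => fderivWithin ℝ (boundaryParam I h₀ x) (coordRange I) z (v k))

/-- The 1-form `⟨(0, θ), ·⟩` given by the outward unit normal `(0, θ)` of `ℝⁿ × Sⁿ⁻¹` in `ℝⁿ × ℝⁿ`
at `(q, θ)`. -/
def normalForm (θ : Vec n) : (Fin 1 → Vec n × Vec n) → ℝ :=
  fun v => inner ℝ θ (v 0).2

/-- The integral `∫_{∂U} f Ω` over the boundary `∂U = {H₀ = 1}` of the star body with smooth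
Hamiltonian `H₀`, through a partition of unity and the parametrization of `∂U` by points `(q, θ)` of
`ℝⁿ × Sⁿ⁻¹`. Here `∂U` is oriented as the boundary of `U` (outward normal first), and
the value of a form `η` of top degree on a positive orthonormal frame of the hypersurface
`ℝⁿ × Sⁿ⁻¹` with outward unit normal `ν` is the value of `ν ∧ η` on a positive orthonormal frame of
`ℝⁿ × ℝⁿ`. -/
def boundaryIntegral [T2Space M] [CompactSpace M] (h₀ : StarHamiltonian I M)
    (f : CotangentBundle I M → ℝ) : ℝ :=
  ∑ᶠ x : M, ∫ q in (extChartAt I x).target,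
    ∫ θ : Metric.sphere (0 : Vec n) 1,
      chartPartition I M x (coord I x (q, (θ : Vec n))).proj *
        f (coord I x (boundaryParam I h₀ x (q, (θ : Vec n)))) *
        wedge (normalForm (θ : Vec n)) (pulledOmega I h₀ x (q, (θ : Vec n)))
          (fun k => canonicalFrame n k)
      ∂(volume : Measure (Vec n)).toSphere

/-- The dual mixed volume `∫_{∂U} ρ₁ ⋯ ρₙ Ω` of `n` star bodies, computed with the model body `U`
(which has to have a smooth Hamiltonian). -/
def dualMixedVolume [T2Space M] [CompactSpace M] (U : StarBody I M) (A : Fin n → StarBody I M) :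
    ℝ :=
  boundaryIntegral I (U.hamiltonian I) (fun p => ∏ i, (A i).radial I p)

end Volume

end StarGeom

end

/-!
# The dual Minkowski inequality for star bodies in a cotangent bundle

In the canonical coordinates `(q, p)` over the preferred chart at a point, the canonical form is
`α = ∑ pᵢ dqᵢ` and the Liouville measure is Lebesgue measure. Both volumes of the theorem then
become integrals over the coordinate unit spheres `|p| = 1`, glued by the same partition of unity:
with `H` the Hamiltonian of `A` and `Hᵢ` that of `Aᵢ`,
`V(A) = ∫ H⁻ⁿ / n` and `Ṽ(A₁, …, Aₙ) = ∫ (H₁ ⋯ Hₙ)⁻¹ / n`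
(`symplecticVolume_eq_sphereIntegral`, `dualMixedVolume_eq_sphereIntegral`). The first is
integration in polar coordinates in each fibre. For the second, the boundary `∂U` is parametrized by
unit covectors through `θ ↦ θ / H₀(θ)`. The pull-back of `dα` differs from `H₀⁻¹ ∑ dpᵢ ∧ dqᵢ` by a
multiple of `α`, so that `Ω` pulls back to `H₀⁻ⁿ / n` times the surface measure, and the factors
`ρᵢ(θ / H₀) = H₀ / Hᵢ` cancel the power of `H₀`.

The values of the forms on the canonical frame are found by writing wedge products as alternations
of tensor products (`wedge_alternation`). Expanding `∑ dpᵢ ∧ dqᵢ` turns a power of it into a sum of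
determinants of block diagonal matrices with two equal blocks, hence into a sum of squares of
determinants (`sum_det_selection_sq`, `sum_det_bordered_sq`).

What remains is Hölder's inequality for the functions `Hᵢ⁻¹` together with its case of equality. It
is obtained by integrating the pointwise inequality between the geometric and the arithmetic mean of
the numbers `(cᵢ Hᵢ)⁻ⁿ`, where `cᵢⁿ = V(Aᵢ)` (`sphereIntegral_meanDeficit`). If equality holds, the
deficit is a continuous nonnegative function with integral zero, so it vanishes identically
(`exists_scale_eq_zero_of_sphereIntegral_eq_zero`), the numbers `cᵢ Hᵢ` agree at each point, and the
Hamiltonians are proportional, which means that the bodies are dilations of each other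
(`StarBody.carrier_eq_dilate_iff`).
-/

noncomputable section

namespace StarGeom

/-! ### Wedge products as alternations -/

section Alternation

variable {Z : Type*}

/-- The unnormalized alternation of a function of `k` vectors. -/
def alternation {k : ℕ} (A : (Fin k → Z) → ℝ) : (Fin k → Z) → ℝ :=
  fun v => ∑ σ : Equiv.Perm (Fin k), ((Equiv.Perm.sign σ : ℤ) : ℝ) * A (fun i => v (σ i))

/-- The tensor product of a function of `k` vectors and a function of `l` vectors. -/
def tensor {k l : ℕ} (A : (Fin k → Z) → ℝ) (B : (Fin l → Z) → ℝ) : (Fin (k + l) → Z) → ℝ :=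
  fun v => A (fun i => v (Fin.castAdd l i)) * B (fun j => v (Fin.natAdd k j))

theorem alternation_comp_perm {k : ℕ} (A : (Fin k → Z) → ℝ) (g : Equiv.Perm (Fin k))
    (v : Fin k → Z) :
    ∑ σ : Equiv.Perm (Fin k), ((Equiv.Perm.sign σ : ℤ) : ℝ) *
      (((Equiv.Perm.sign g : ℤ) : ℝ) * A (fun i => v (σ (g i)))) = alternation A v := by
  conv_rhs => rw [alternation, ← Equiv.sum_comp (Equiv.mulRight g)]
  refine Finset.sum_congr rfl fun σ _ => ?_
  simp [mul_assoc]

/-- The factorials in the wedge product count the pairs of permutations that the two alternations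
contribute, each of which is absorbed by the outer alternation. -/
theorem wedge_alternation {k l : ℕ} (A : (Fin k → Z) → ℝ) (B : (Fin l → Z) → ℝ) :
    wedge (alternation A) (alternation B) = alternation (tensor A B) := by
  funext v
  let g : Equiv.Perm (Fin k) → Equiv.Perm (Fin l) → Equiv.Perm (Fin (k + l)) := fun τ ρ =>
    finSumFinEquiv.permCongr (Equiv.Perm.sumCongr τ ρ)
  have hg : ∀ τ ρ, ((Equiv.Perm.sign (g τ ρ) : ℤ) : ℝ) =
      ((Equiv.Perm.sign τ : ℤ) : ℝ) * ((Equiv.Perm.sign ρ : ℤ) : ℝ) := by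
    intro τ ρ
    simp [g, Equiv.Perm.sign_permCongr, Equiv.Perm.sign_sumCongr]
  have h1 : ∀ σ : Equiv.Perm (Fin (k + l)), ((Equiv.Perm.sign σ : ℤ) : ℝ) *
      alternation A (fun i => v (σ (Fin.castAdd l i))) *
      alternation B (fun j => v (σ (Fin.natAdd k j))) =
      ∑ τ, ∑ ρ, ((Equiv.Perm.sign σ : ℤ) : ℝ) *
        (((Equiv.Perm.sign (g τ ρ) : ℤ) : ℝ) * tensor A B (fun i => v (σ (g τ ρ i)))) := by
    intro σ
    rw [mul_assoc, alternation, alternation, Finset.sum_mul_sum, Finset.mul_sum]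
    refine Finset.sum_congr rfl fun τ _ => ?_
    rw [Finset.mul_sum]
    refine Finset.sum_congr rfl fun ρ _ => ?_
    rw [hg]
    simp only [tensor, g, Equiv.permCongr_apply, finSumFinEquiv_symm_apply_castAdd,
      finSumFinEquiv_symm_apply_natAdd, Equiv.Perm.sumCongr_apply, Sum.map_inl, Sum.map_inr,
      finSumFinEquiv_apply_left, finSumFinEquiv_apply_right]
    ring
  have h2 : ∑ σ : Equiv.Perm (Fin (k + l)), ((Equiv.Perm.sign σ : ℤ) : ℝ) *
      alternation A (fun i => v (σ (Fin.castAdd l i))) *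
      alternation B (fun j => v (σ (Fin.natAdd k j))) =
      ∑ _τ : Equiv.Perm (Fin k), ∑ _ρ : Equiv.Perm (Fin l), alternation (tensor A B) v := by
    simp only [h1]
    rw [Finset.sum_comm]
    refine Finset.sum_congr rfl fun τ _ => ?_
    rw [Finset.sum_comm]
    exact Finset.sum_congr rfl fun ρ _ => alternation_comp_perm _ _ _
  simp only [wedge]
  rw [h2]
  simp only [Finset.sum_const, Finset.card_univ, Fintype.card_perm, Fintype.card_fin, nsmul_eq_mul]
  have := Nat.factorial_ne_zero k
  have := Nat.factorial_ne_zero l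
  field_simp

theorem alternation_one (A : (Fin 1 → Z) → ℝ) : alternation A = A := by
  funext v
  simp [alternation]

theorem alternation_two (B : (Fin 2 → Z) → ℝ) (v : Fin 2 → Z) :
    alternation B v = B v - B ![v 1, v 0] := by
  have h : (Finset.univ : Finset (Equiv.Perm (Fin 2))) = {1, Equiv.swap 0 1} := by decide
  have e1 : (fun i => v ((1 : Equiv.Perm (Fin 2)) i)) = v := rfl
  have e2 : (fun i => v (Equiv.swap 0 1 i)) = ![v 1, v 0] := by
    funext i; fin_cases i <;> simp
  rw [alternation, h, Finset.sum_pair (by decide), e1, e2]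
  simp [sub_eq_add_neg]

/-- The tensor power `B ⊗ ⋯ ⊗ B` of a function of two vectors. -/
def tensorPow (B : (Fin 2 → Z) → ℝ) : (k : ℕ) → (Fin (2 * k) → Z) → ℝ
  | 0 => fun _ => 1
  | k + 1 => tensor (tensorPow B k) B

theorem wedgePow_alternation (B : (Fin 2 → Z) → ℝ) (k : ℕ) :
    wedgePow (alternation B) k = alternation (tensorPow B k) := by
  induction k with
  | zero =>
    funext v
    simp only [wedgePow, alternation, tensorPow]
    rw [show (Finset.univ : Finset (Equiv.Perm (Fin (2 * 0)))) = {1} from by decide]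
    simp
  | succ k ih => rw [wedgePow, ih, wedge_alternation]; rfl

theorem tensorPow_apply (B : Z → Z → ℝ) (k : ℕ) (v : Fin (2 * k) → Z) :
    tensorPow (fun u => B (u 0) (u 1)) k v =
      ∏ j : Fin k, B (v ⟨2 * j, by omega⟩) (v ⟨2 * j + 1, by omega⟩) := by
  induction k with
  | zero => simp [tensorPow]
  | succ k ih =>
    rw [Fin.prod_univ_castSucc, tensorPow, tensor, ih]
    rfl

/-- The alternation of a product of functions of one vector is a determinant. -/
theorem alternation_prod {N : ℕ} (R : Fin N → Z → ℝ) (v : Fin N → Z) :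
    alternation (fun u => ∏ r, R r (u r)) v = (Matrix.of fun s r => R r (v s)).det := by
  rw [Matrix.det_apply']
  rfl

theorem alternation_sum {ι : Type*} (s : Finset ι) {k : ℕ} (A : ι → (Fin k → Z) → ℝ)
    (v : Fin k → Z) : alternation (fun u => ∑ i ∈ s, A i u) v = ∑ i ∈ s, alternation (A i) v := by
  simp only [alternation, Finset.mul_sum]
  exact Finset.sum_comm

end Alternation

/-! ### Alternated products of pairs of 1-forms -/

section Pairs

/-- The numbering `(j, s) ↦ 2 j + s` of `n` pairs. -/
def pairEquiv {n N : ℕ} (h : n * 2 = N) : Fin n × Fin 2 ≃ Fin N :=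
  finProdFinEquiv.trans (finCongr h)

theorem pairEquiv_val {n N : ℕ} (h : n * 2 = N) (j : Fin n) (s : Fin 2) :
    (pairEquiv h (j, s)).val = 2 * j.val + s.val := by
  simp [pairEquiv, add_comm]

variable {Z : Type*}

theorem alternation_pairs {n N : ℕ} (h : n * 2 = N) (X Y : Fin n → Z → ℝ) (v : Fin N → Z) :
    alternation (fun u => ∏ j, X j (u (pairEquiv h (j, 0))) * Y j (u (pairEquiv h (j, 1)))) v =
      (Matrix.of fun s r : Fin n × Fin 2 => (![X r.1, Y r.1] r.2) (v (pairEquiv h s))).det := by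
  have := alternation_prod
    (fun r => ![X ((pairEquiv h).symm r).1, Y ((pairEquiv h).symm r).1] ((pairEquiv h).symm r).2) v
  rw [← Matrix.det_submatrix_equiv_self (pairEquiv h)] at this
  convert this using 2
  · funext u
    rw [← Equiv.prod_comp (pairEquiv h), Fintype.prod_prod_type]
    simp
  · ext s r
    simp

theorem alternation_pairs_eq_zero {n N : ℕ} (h : n * 2 = N) (X Y : Fin n → Z → ℝ) (v : Fin N → Z)
    {i j : Fin n} (hij : i ≠ j) (hY : Y i = Y j) :
    alternation (fun u => ∏ j, X j (u (pairEquiv h (j, 0))) * Y j (u (pairEquiv h (j, 1)))) v =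
      0 := by
  rw [alternation_pairs]
  refine Matrix.det_zero_of_column_eq (i := (i, 1)) (j := (j, 1)) (by simpa using hij) fun k => ?_
  simp [hY]

theorem canonicalFrame_two_mul {n : ℕ} (i : Fin n) :
    canonicalFrame n (2 * i.val) = (0, EuclideanSpace.single i 1) := by
  simp only [canonicalFrame, Nat.mul_mod_right, if_true]
  refine Prod.ext rfl ?_
  ext j
  simp [Fin.ext_iff]

theorem canonicalFrame_two_mul_add_one {n : ℕ} (i : Fin n) :
    canonicalFrame n (2 * i.val + 1) = (EuclideanSpace.single i 1, 0) := by
  have h1 : (2 * i.val + 1) % 2 = 1 := by omega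
  have h2 : (2 * i.val + 1) / 2 = i.val := by omega
  simp only [canonicalFrame, h1, h2, one_ne_zero, if_false]
  refine Prod.ext ?_ rfl
  ext j
  simp [Fin.ext_iff]

/-- On the canonical frame, an alternated product of forms in the `dpᵢ` and forms in the `dqᵢ` is
the determinant of a block diagonal matrix. -/
theorem alternation_pairs_canonicalFrame {n N : ℕ} (h : n * 2 = N)
    (X Y : Fin n → Vec n × Vec n → ℝ) (a b : Matrix (Fin n) (Fin n) ℝ)
    (hXp : ∀ i j, X j (0, EuclideanSpace.single i 1) = a i j)
    (hXq : ∀ i j, X j (EuclideanSpace.single i 1, 0) = 0)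
    (hYp : ∀ i j, Y j (0, EuclideanSpace.single i 1) = 0)
    (hYq : ∀ i j, Y j (EuclideanSpace.single i 1, 0) = b i j) :
    alternation (fun u => ∏ j, X j (u (pairEquiv h (j, 0))) * Y j (u (pairEquiv h (j, 1))))
      (fun k => canonicalFrame n k) = a.det * b.det := by
  rw [alternation_pairs]
  have : (Matrix.of fun s r : Fin n × Fin 2 =>
      (![X r.1, Y r.1] r.2) (canonicalFrame n (pairEquiv h s))) =
      Matrix.blockDiagonal ![a, b] := by
    ext ⟨i, s⟩ ⟨j, t⟩
    rw [Matrix.of_apply, Matrix.blockDiagonal_apply, pairEquiv_val]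
    fin_cases s <;> fin_cases t <;>
      simp [canonicalFrame_two_mul, canonicalFrame_two_mul_add_one, hXp, hXq, hYp, hYq]
  rw [this, Matrix.det_blockDiagonal, Fin.prod_univ_two]
  rfl

end Pairs

/-! ### Sums of squares of determinants -/

section Determinants

/-- The matrix whose columns are the standard basis vectors numbered by `c`. -/
def selection {n : ℕ} (c : Fin n → Fin n) : Matrix (Fin n) (Fin n) ℝ :=
  Matrix.of fun i j => if i = c j then 1 else 0

theorem det_selection_of_not_injective {n : ℕ} {c : Fin n → Fin n} (hc : ¬ Function.Injective c) :
    (selection c).det = 0 := by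
  simp only [Function.Injective, not_forall] at hc
  obtain ⟨i, j, h, hij⟩ := hc
  exact Matrix.det_zero_of_column_eq hij fun k => by simp [selection, h]

theorem det_selection_sq_of_injective {n : ℕ} {c : Fin n → Fin n} (hc : Function.Injective c) :
    (selection c).det ^ 2 = 1 := by
  have h : (selection c).transpose * selection c = 1 := by
    ext i j
    simp [selection, Matrix.mul_apply, Matrix.one_apply, hc.eq_iff, eq_comm]
  have := congrArg Matrix.det h
  rwa [Matrix.det_mul, Matrix.det_transpose, Matrix.det_one, ← sq] at this

theorem sum_det_selection_sq (n : ℕ) :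
    ∑ c : Fin n → Fin n, (selection c).det ^ 2 = n.factorial := by
  classical
  have h : ∀ c : Fin n → Fin n,
      (selection c).det ^ 2 = if Function.Injective c then (1 : ℝ) else 0 := by
    intro c
    split_ifs with hc
    · exact det_selection_sq_of_injective hc
    · rw [det_selection_of_not_injective hc]; simp
  simp only [h]
  rw [Finset.sum_boole, ← Fintype.card_subtype,
    Fintype.card_congr (Equiv.subtypeInjectiveEquivEmbedding (Fin n) (Fin n)),
    Fintype.card_embedding_eq]
  simp [Nat.descFactorial_self]

theorem sum_det_selection_cons_sq {m : ℕ} (a : Fin (m + 1)) :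
    ∑ c : Fin m → Fin (m + 1), (selection (Fin.cons a c : Fin (m + 1) → Fin (m + 1))).det ^ 2 =
      m.factorial := by
  classical
  have h : ∀ c : Fin m → Fin (m + 1),
      (selection (Fin.cons a c : Fin (m + 1) → Fin (m + 1))).det ^ 2 =
        if a ∉ range c ∧ Function.Injective c then (1 : ℝ) else 0 := by
    intro c
    split_ifs with hc
    · exact det_selection_sq_of_injective (Fin.cons_injective_iff.2 hc)
    · rw [det_selection_of_not_injective (fun h => hc (Fin.cons_injective_iff.1 h))]; simp
  let E : {c : Fin m → Fin (m + 1) // a ∉ range c ∧ Function.Injective c} ≃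
      (Fin m ↪ {x : Fin (m + 1) // x ≠ a}) :=
    { toFun := fun c => ⟨fun j => ⟨c.1 j, fun e => c.2.1 ⟨j, e⟩⟩,
        fun i j e => c.2.2 (congrArg Subtype.val e)⟩
      invFun := fun f => ⟨fun j => (f j).1, by rintro ⟨j, e⟩; exact (f j).2 e,
        fun i j e => f.injective (Subtype.ext e)⟩
      left_inv := fun c => rfl
      right_inv := fun f => rfl }
  simp only [h]
  rw [Finset.sum_boole, ← Fintype.card_subtype, Fintype.card_congr E, Fintype.card_embedding_eq]
  simp [Nat.descFactorial_self]

/-- The matrix with first column `θ` and the standard basis vectors numbered by `c` as the other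
columns. -/
def bordered {m : ℕ} (θ : Fin (m + 1) → ℝ) (c : Fin m → Fin (m + 1)) :
    Matrix (Fin (m + 1)) (Fin (m + 1)) ℝ :=
  Matrix.of fun i j => (Fin.cons (θ i) (fun k => if i = c k then 1 else 0) : Fin (m + 1) → ℝ) j

/-- Expansion of the determinant along the column `θ`. -/
theorem det_bordered {m : ℕ} (θ : Fin (m + 1) → ℝ) (c : Fin m → Fin (m + 1)) :
    (bordered θ c).det = ∑ a, θ a * (selection (Fin.cons a c : Fin (m + 1) → Fin (m + 1))).det := by
  rw [Matrix.det_succ_column_zero]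
  refine Finset.sum_congr rfl fun a _ => ?_
  rw [Matrix.det_succ_column_zero (selection _), Finset.sum_eq_single a]
  · have : (bordered θ c).submatrix a.succAbove Fin.succ =
        (selection (Fin.cons a c : Fin (m + 1) → Fin (m + 1))).submatrix a.succAbove Fin.succ := by
      ext i j
      simp [bordered, selection]
    rw [this]
    simp only [bordered, selection, Matrix.of_apply, Fin.cons_zero, if_true]
    ring
  · intro i _ hi
    simp [selection, hi]
  · simp

/-- The vector `θ` completed by `m` standard basis vectors in all ways: a Cauchy-Binet identity. -/
theorem sum_det_bordered_sq {m : ℕ} (θ : Fin (m + 1) → ℝ) :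
    ∑ c : Fin m → Fin (m + 1), (bordered θ c).det ^ 2 = m.factorial * ∑ a, θ a ^ 2 := by
  have h : ∀ c, (bordered θ c).det ^ 2 =
      ∑ a, θ a ^ 2 * (selection (Fin.cons a c : Fin (m + 1) → Fin (m + 1))).det ^ 2 := by
    intro c
    rw [det_bordered, sq, Finset.sum_mul_sum]
    refine Finset.sum_congr rfl fun a _ => ?_
    rw [Finset.sum_eq_single a]
    · ring
    · intro b _ hb
      -- Two completions of `c` to a permutation agree.
      have : ¬ (Function.Injective (Fin.cons a c : Fin (m + 1) → Fin (m + 1)) ∧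
          Function.Injective (Fin.cons b c : Fin (m + 1) → Fin (m + 1))) := by
        rintro ⟨ha, hb'⟩
        obtain ⟨j, hj⟩ := (Finite.injective_iff_surjective.1 ha) b
        revert hj
        refine Fin.cases (fun hj => hb hj.symm) (fun k hk => ?_) j
        exact (Fin.cons_injective_iff.1 hb').1 ⟨k, hk⟩
      rw [not_and_or] at this
      rcases this with h | h <;> rw [det_selection_of_not_injective h] <;> simp
    · simp
  simp only [h]
  rw [Finset.sum_comm]
  simp only [← Finset.mul_sum, sum_det_selection_cons_sq]
  rw [← Finset.sum_mul, mul_comm]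

end Determinants

/-! ### Values of forms on the canonical frame -/

section FrameValues

theorem tensorPow_sum {Z ι : Type*} [Fintype ι] (P Q : ι → Z → ℝ) (k : ℕ) (v : Fin (2 * k) → Z) :
    tensorPow (fun u => ∑ i, P i (u 0) * Q i (u 1)) k v =
      ∑ c : Fin k → ι, ∏ j : Fin k,
        P (c j) (v ⟨2 * j, by omega⟩) * Q (c j) (v ⟨2 * j + 1, by omega⟩) := by
  classical
  rw [tensorPow_apply (fun x y => ∑ i, P i x * Q i y), Finset.prod_univ_sum,
    Fintype.piFinset_univ]

theorem inner_eq_sum {n : ℕ} (x y : Vec n) : inner ℝ x y = ∑ i, x i * y i := by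
  rw [PiLp.inner_apply]
  exact Finset.sum_congr rfl fun i _ => by simp [mul_comm]

/-- The `n`-th power of the standard symplectic form `∑ dpᵢ ∧ dqᵢ` takes the value `n!` on the
canonical frame. -/
theorem wedgePow_canonicalFrame (n : ℕ) :
    wedgePow (fun v : Fin 2 → Vec n × Vec n =>
      inner ℝ (v 0).2 (v 1).1 - inner ℝ (v 1).2 (v 0).1) n (fun k => canonicalFrame n k) =
      n.factorial := by
  have hω : (fun v : Fin 2 → Vec n × Vec n =>
      (inner ℝ (v 0).2 (v 1).1 - inner ℝ (v 1).2 (v 0).1 : ℝ)) =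
      alternation (fun u => ∑ i : Fin n, (u 0).2 i * (u 1).1 i) := by
    funext v
    simp [alternation_two, inner_eq_sum]
  rw [hω, wedgePow_alternation]
  have hT : tensorPow (fun u : Fin 2 → Vec n × Vec n => ∑ i : Fin n, (u 0).2 i * (u 1).1 i) n =
      fun v => ∑ c : Fin n → Fin n, ∏ j : Fin n,
        (v (pairEquiv (mul_comm n 2) (j, 0))).2 (c j) *
          (v (pairEquiv (mul_comm n 2) (j, 1))).1 (c j) := by
    funext v
    rw [tensorPow_sum (fun i (z : Vec n × Vec n) => z.2 i) (fun i z => z.1 i)]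
    refine Finset.sum_congr rfl fun c _ => Finset.prod_congr rfl fun j _ => ?_
    rw [show pairEquiv (mul_comm n 2) (j, 0) = ⟨2 * j, by omega⟩ from
        Fin.ext (by rw [pairEquiv_val]; rfl),
      show pairEquiv (mul_comm n 2) (j, 1) = ⟨2 * j + 1, by omega⟩ from
        Fin.ext (by rw [pairEquiv_val]; rfl)]
  rw [hT, alternation_sum, ← sum_det_selection_sq]
  refine Finset.sum_congr rfl fun c _ => ?_
  rw [alternation_pairs_canonicalFrame (mul_comm n 2) (fun j z => z.2 (c j)) (fun j z => z.1 (c j))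
    (selection c) (selection c), sq] <;> intro i j <;> simp [selection, eq_comm]

/-- The value on the canonical frame of `ν ∧ α ∧ (dα)ᵐ`, where `ν = ⟨θ, dp⟩` for a unit vector `θ`,
`α = s ⟨θ, dq⟩` and `dα = s ∑ dpᵢ ∧ dqᵢ + L ∧ ⟨θ, dq⟩`. The term with `L` contributes nothing,
because it is a multiple of `α`. -/
theorem wedge_wedge_wedgePow_canonicalFrame {m : ℕ} (θ : Vec (m + 1)) (hθ : ‖θ‖ = 1) {s : ℝ}
    (hs : s ≠ 0) (L : Vec (m + 1) × Vec (m + 1) → ℝ) :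
    wedge (normalForm θ) (wedge
      (fun v : Fin 1 → Vec (m + 1) × Vec (m + 1) => s * inner ℝ θ (v 0).1)
      (wedgePow (fun v : Fin 2 → Vec (m + 1) × Vec (m + 1) =>
        inner ℝ (s • (v 0).2 + L (v 0) • θ) (v 1).1 -
          inner ℝ (s • (v 1).2 + L (v 1) • θ) (v 0).1) m))
      (fun k => canonicalFrame (m + 1) k) = s ^ (m + 1) * m.factorial := by
  -- The index `none` stands for the term `L ∧ ⟨θ, dq⟩`.
  let P : Option (Fin (m + 1)) → Vec (m + 1) × Vec (m + 1) → ℝ := fun o z =>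
    o.elim (s⁻¹ * L z) (fun i => z.2 i)
  let Q : Option (Fin (m + 1)) → Vec (m + 1) × Vec (m + 1) → ℝ := fun o z =>
    o.elim (s * inner ℝ θ z.1) (fun i => s * z.1 i)
  let X : (Fin m → Option (Fin (m + 1))) → Fin (m + 1) → Vec (m + 1) × Vec (m + 1) → ℝ := fun c =>
    Fin.cons (fun z => inner ℝ θ z.2) (fun j => P (c j))
  let Y : (Fin m → Option (Fin (m + 1))) → Fin (m + 1) → Vec (m + 1) × Vec (m + 1) → ℝ := fun c =>
    Fin.cons (fun z => s * inner ℝ θ z.1) (fun j => Q (c j))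
  have hN : (m + 1) * 2 = 1 + (1 + 2 * m) := by ring
  have hB : ∀ z w : Vec (m + 1) × Vec (m + 1),
      inner ℝ (s • z.2 + L z • θ) w.1 = ∑ o, P o z * Q o w := by
    intro z w
    rw [Fintype.sum_option]
    simp only [P, Q, Option.elim, inner_add_left, real_inner_smul_left]
    rw [inner_eq_sum z.2, Finset.mul_sum, add_comm]
    congr 1
    · field_simp
    · exact Finset.sum_congr rfl fun i _ => by ring
  have hω : (fun v : Fin 2 → Vec (m + 1) × Vec (m + 1) =>
      (inner ℝ (s • (v 0).2 + L (v 0) • θ) (v 1).1 -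
        inner ℝ (s • (v 1).2 + L (v 1) • θ) (v 0).1 : ℝ)) =
      alternation (fun u => ∑ o, P o (u 0) * Q o (u 1)) := by
    funext v
    simp only [alternation_two, hB]
    simp
  rw [hω, wedgePow_alternation, ← alternation_one (normalForm θ),
    ← alternation_one (fun v : Fin 1 → Vec (m + 1) × Vec (m + 1) => s * inner ℝ θ (v 0).1),
    wedge_alternation, wedge_alternation]
  have hT : tensor (normalForm θ)
      (tensor (fun v : Fin 1 → Vec (m + 1) × Vec (m + 1) => s * inner ℝ θ (v 0).1)
        (tensorPow (fun u => ∑ o, P o (u 0) * Q o (u 1)) m)) =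
      fun v => ∑ c : Fin m → Option (Fin (m + 1)), ∏ j : Fin (m + 1),
        X c j (v (pairEquiv hN (j, 0))) * Y c j (v (pairEquiv hN (j, 1))) := by
    funext v
    simp only [tensor, tensorPow_sum, Finset.mul_sum]
    refine Finset.sum_congr rfl fun c _ => ?_
    rw [Fin.prod_univ_succ, ← mul_assoc]
    congr 1
    refine Finset.prod_congr rfl fun j _ => ?_
    rw [show pairEquiv hN (j.succ, 0) = Fin.natAdd _ (Fin.natAdd _ ⟨2 * j, by omega⟩) from
        Fin.ext (by rw [pairEquiv_val]; simp; ring),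
      show pairEquiv hN (j.succ, 1) = Fin.natAdd _ (Fin.natAdd _ ⟨2 * j + 1, by omega⟩) from
        Fin.ext (by rw [pairEquiv_val]; simp; ring)]
    rfl
  rw [hT, alternation_sum]
  have hsome : ∀ c : Fin m → Fin (m + 1),
      s ^ (m + 1) * (bordered (fun i => θ i) c).det ^ 2 =
      alternation (fun u => ∏ j : Fin (m + 1), X (fun k => some (c k)) j (u (pairEquiv hN (j, 0))) *
        Y (fun k => some (c k)) j (u (pairEquiv hN (j, 1))))
        (fun k => canonicalFrame (m + 1) k) := by
    intro c
    rw [alternation_pairs_canonicalFrame hN _ _ (bordered (fun i => θ i) c)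
      (s • bordered (fun i => θ i) c)]
    · rw [Matrix.det_smul, Fintype.card_fin]
      ring
    all_goals
      intro i j
      refine Fin.cases ?_ (fun k => ?_) j <;>
        simp [X, Y, P, Q, bordered, inner_eq_sum, eq_comm]
  rw [← Fintype.sum_of_injective
    (fun (c : Fin m → Fin (m + 1)) (k : Fin m) => (some (c k) : Option (Fin (m + 1)))) ?_
    _ _ ?_ hsome]
  · rw [← Finset.mul_sum, sum_det_bordered_sq, ← EuclideanSpace.real_norm_sq_eq, hθ]
    simp
  · intro c c' h
    funext k
    exact Option.some_injective _ (congrFun h k)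
  · intro c hc
    have : ∃ k, c k = none := by
      by_contra hne
      push Not at hne
      choose d hd using fun k => Option.ne_none_iff_exists'.1 (hne k)
      exact hc ⟨d, (funext hd).symm⟩
    obtain ⟨k, hk⟩ := this
    refine alternation_pairs_eq_zero hN (X c) (Y c) _ (i := 0) (j := k.succ)
      (Fin.succ_ne_zero k).symm ?_
    simp [Y, Q, hk]

theorem wedgePow_comp {Z W : Type*} (a : (Fin 2 → W) → ℝ) (g : Z → W) (k : ℕ) :
    (fun v : Fin (2 * k) → Z => wedgePow a k (fun i => g (v i))) =
      wedgePow (fun v => a (fun i => g (v i))) k := by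
  induction k with
  | zero => rfl
  | succ k ih => simp only [wedgePow]; rw [← ih]; rfl

end FrameValues

/-! ### Canonical coordinates on the cotangent bundle -/

section Coordinates

variable {n : ℕ} {H : Type*} [TopologicalSpace H] (I : ModelWithCorners ℝ (Vec n) H)
  {M : Type*} [TopologicalSpace M] [ChartedSpace H M] [IsManifold I ∞ M]

theorem extChartAt_cotangent_target (x : M) :
    (extChartAt (cotangentModel I) (⟨x, 0⟩ : CotangentBundle I M)).target =
      (extChartAt I x).target ×ˢ univ := by
  rw [FiberBundle.extChartAt_target]
  congr 1
  refine inter_eq_left.2 fun q hq => ?_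
  simp only [mem_preimage, hom_trivializationAt_baseSet]
  refine ⟨?_, mem_univ _⟩
  rw [TangentBundle.trivializationAt_baseSet, ← extChartAt_source I]
  exact (extChartAt I x).map_target hq

theorem extChartAt_cotangent_source (x : M) :
    (extChartAt (cotangentModel I) (⟨x, 0⟩ : CotangentBundle I M)).source =
      {P | P.proj ∈ (extChartAt I x).source} := by
  rw [FiberBundle.extChartAt]
  ext P
  simp only [PartialEquiv.trans_source, PartialEquiv.prod_source, mem_inter_iff, mem_preimage,
    mem_prod, mem_ofPred_eq]
  constructor
  · rintro ⟨_, h, _⟩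
    exact h
  · intro h
    refine ⟨?_, h, mem_univ _⟩
    rw [extChartAt_source] at h
    exact ⟨h, mem_univ _⟩

/-- The covector at `y` with coordinate vector `p`, in the chart at `x`. -/
def coordCovector (x y : M) (p : Vec n) : TangentSpace I y →L[ℝ] ℝ :=
  (innerSL ℝ p).comp
    ((trivializationAt (Vec n) (TangentSpace I : M → Type _) x).continuousLinearMapAt ℝ y)

/-- `coord` is the inverse of the chart on base points and the dual of its derivative on fibres. -/
theorem coord_eq (x : M) (z : Vec n × Vec n) :
    coord I x z =
      ⟨(extChartAt I x).symm z.1, coordCovector I x ((extChartAt I x).symm z.1) z.2⟩ := by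
  have h : coord I x z = ⟨(extChartAt I x).symm z.1,
      ((trivializationAt ℝ (Bundle.Trivial M ℝ) x).symmL ℝ ((extChartAt I x).symm z.1)).comp
        (coordCovector I x ((extChartAt I x).symm z.1) z.2)⟩ := rfl
  rw [h]
  congr 1
  have h1 : (trivializationAt ℝ (Bundle.Trivial M ℝ) x).symmL ℝ ((extChartAt I x).symm z.1) =
      ContinuousLinearMap.id ℝ ℝ := Bundle.Trivial.symmL_trivialization ℝ M ℝ _
  rw [h1]
  rfl

theorem coord_proj (x : M) (z : Vec n × Vec n) :
    (coord I x z).proj = (extChartAt I x).symm z.1 := rfl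

theorem coord_smul (x : M) (q p : Vec n) (t : ℝ) :
    coord I x (q, t • p) = scale I t (coord I x (q, p)) := by
  rw [coord_eq, coord_eq, scale]
  simp only
  congr 1
  rw [coordCovector, map_smul, ContinuousLinearMap.smul_comp]
  rfl

theorem continuousOn_coord (x : M) :
    ContinuousOn (coord I x) ((extChartAt I x).target ×ˢ univ) := by
  have h := continuousOn_extChartAt_symm (I := cotangentModel I) (⟨x, 0⟩ : CotangentBundle I M)
  rw [extChartAt_cotangent_target] at h
  refine h.comp (f := fun z : Vec n × Vec n => (z.1, innerSL ℝ z.2)) ?_ ?_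
  · fun_prop
  · exact fun z hz => ⟨hz.1, mem_univ _⟩

theorem coord_snd_ne_zero (x : M) {z : Vec n × Vec n} (hz : z.1 ∈ (extChartAt I x).target)
    (hp : z.2 ≠ 0) : (coord I x z).snd ≠ 0 := by
  rw [coord_eq]
  intro h
  apply hp
  have hb : (extChartAt I x).symm z.1 ∈
      (trivializationAt (Vec n) (TangentSpace I : M → Type _) x).baseSet := by
    rw [TangentBundle.trivializationAt_baseSet, ← extChartAt_source I]
    exact (extChartAt I x).map_target hz
  set e := trivializationAt (Vec n) (TangentSpace I : M → Type _) x
  have h2 := DFunLike.congr_fun h (e.symmL ℝ ((extChartAt I x).symm z.1) z.2)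
  have h3 : inner ℝ z.2 (e.continuousLinearMapAt ℝ ((extChartAt I x).symm z.1)
      (e.symmL ℝ ((extChartAt I x).symm z.1) z.2)) = (0 : ℝ) := h2
  rw [Bundle.Trivialization.continuousLinearMapAt_symmL _ hb] at h3
  exact inner_self_eq_zero.1 h3

/-- Canonical coordinates reach every covector over the domain of the chart. -/
theorem exists_coord_eq (x : M) (P : CotangentBundle I M)
    (hP : P.proj ∈ (extChartAt I x).source) :
    ∃ p : Vec n, P = coord I x (extChartAt I x P.proj, p) := by
  have hP' : P ∈ (extChartAt (cotangentModel I) (⟨x, 0⟩ : CotangentBundle I M)).source := by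
    rw [extChartAt_cotangent_source]; exact hP
  refine ⟨(InnerProductSpace.toDual ℝ (Vec n)).symm
    (extChartAt (cotangentModel I) (⟨x, 0⟩ : CotangentBundle I M) P).2, ?_⟩
  have h1 : innerSL ℝ ((InnerProductSpace.toDual ℝ (Vec n)).symm
    (extChartAt (cotangentModel I) (⟨x, 0⟩ : CotangentBundle I M) P).2) =
    (extChartAt (cotangentModel I) (⟨x, 0⟩ : CotangentBundle I M) P).2 :=
    (InnerProductSpace.toDual ℝ (Vec n)).apply_symm_apply _
  rw [coord, h1]
  exact ((extChartAt (cotangentModel I) (⟨x, 0⟩ : CotangentBundle I M)).left_inv hP').symm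

theorem contMDiffWithinAt_coord (x : M) {z : Vec n × Vec n} (hz : z.1 ∈ (extChartAt I x).target) :
    ContMDiffWithinAt 𝓘(ℝ, Vec n × Vec n) (cotangentModel I) ∞ (coord I x) (coordRange I) z := by
  have h := contMDiffWithinAt_extChartAt_symm_range (I := cotangentModel I) (n := ∞)
    (⟨x, 0⟩ : CotangentBundle I M) (y := (z.1, innerSL ℝ z.2))
    (by rw [extChartAt_cotangent_target]; exact ⟨hz, mem_univ _⟩)
  refine h.comp (I' := 𝓘(ℝ, Vec n × (Vec n →L[ℝ] ℝ))) z
    (f := fun z : Vec n × Vec n => (z.1, innerSL ℝ z.2)) ?_ ?_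
  · refine ContDiffWithinAt.contMDiffWithinAt (ContDiff.contDiffWithinAt ?_)
    exact contDiff_fst.prodMk ((innerSL ℝ).contDiff.comp contDiff_snd)
  · intro w hw
    rw [ModelWithCorners.range_prod]
    exact ⟨hw.1, by simp⟩

theorem uniqueDiffOn_coordRange : UniqueDiffOn ℝ (coordRange I) :=
  I.uniqueDiffOn.prod uniqueDiffOn_univ

omit [IsManifold I ∞ M] in
theorem coordRange_mem (x : M) {z : Vec n × Vec n} (hz : z.1 ∈ (extChartAt I x).target) :
    z ∈ coordRange I := ⟨extChartAt_target_subset_range x hz, mem_univ _⟩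

omit [IsManifold I ∞ M] in
theorem target_mem_nhdsWithin (x : M) {z : Vec n × Vec n} (hz : z.1 ∈ (extChartAt I x).target) :
    ∀ᶠ w in 𝓝[coordRange I] z, w.1 ∈ (extChartAt I x).target := by
  have h := extChartAt_target_mem_nhdsWithin_of_mem hz
  refine (Filter.Tendsto.eventually (f := Prod.fst) ?_ h)
  exact tendsto_nhdsWithin_iff.2 ⟨(continuous_fst.tendsto z).mono_left nhdsWithin_le_nhds,
    eventually_mem_nhdsWithin.mono fun w hw => hw.1⟩


/-- In canonical coordinates `α = ∑ pᵢ dqᵢ`: the derivative of the chart that defines the covector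
with coordinates `p` cancels the derivative of the inverse chart, by which `coord` moves the base
point. -/
theorem canonicalForm_comp_mfderivWithin_coord (x : M) {z : Vec n × Vec n}
    (hz : z.1 ∈ (extChartAt I x).target) :
    ContinuousLinearMap.comp (canonicalForm I (coord I x z))
      (mfderivWithin 𝓘(ℝ, Vec n × Vec n) (cotangentModel I) (coord I x) (coordRange I) z) =
      (innerSL ℝ z.2).comp (ContinuousLinearMap.fst ℝ (Vec n) (Vec n)) := by
  have hzr := coordRange_mem I x hz
  have hU : UniqueMDiffWithinAt 𝓘(ℝ, Vec n × Vec n) (coordRange I) z :=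
    (uniqueDiffOn_coordRange I z hzr).uniqueMDiffWithinAt
  have hc : MDifferentiableWithinAt 𝓘(ℝ, Vec n × Vec n) (cotangentModel I) (coord I x)
      (coordRange I) z := (contMDiffWithinAt_coord I x hz).mdifferentiableWithinAt (by simp)
  have hπ : MDifferentiableAt (cotangentModel I) I (fun q : CotangentBundle I M => q.proj)
      (coord I x z) :=
    (Bundle.contMDiff_proj (n := ∞) (fun x : M => TangentSpace I x →L[ℝ] Bundle.Trivial M ℝ x)
      |>.contMDiffAt).mdifferentiableAt (by simp)
  have hfst : HasMFDerivWithinAt 𝓘(ℝ, Vec n × Vec n) 𝓘(ℝ, Vec n) (Prod.fst : Vec n × Vec n → Vec n)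
      (coordRange I) z (ContinuousLinearMap.fst ℝ (Vec n) (Vec n)) :=
    hasFDerivWithinAt_fst.hasMFDerivWithinAt
  have h1 := mfderiv_comp_mfderivWithin z hπ hc hU
  have h2 := mfderivWithin_comp z (s := coordRange I) (u := range I) (I := 𝓘(ℝ, Vec n × Vec n))
    (mdifferentiableWithinAt_extChartAt_symm hz) hfst.mdifferentiableWithinAt
    (fun w hw => hw.1) hU
  rw [hfst.mfderivWithin hU] at h2
  have h3 := mfderiv_extChartAt_comp_mfderivWithin_extChartAt_symm hz
  have h4 : ((fun q : CotangentBundle I M => q.proj) ∘ coord I x) =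
      (extChartAt I x).symm ∘ (Prod.fst : Vec n × Vec n → Vec n) := rfl
  have hs : (extChartAt I x).symm z.1 ∈ (chartAt H x).source := by
    rw [← extChartAt_source I]
    exact (extChartAt I x).map_target hz
  rw [h4, h2] at h1
  ext1 v
  have h1v := DFunLike.congr_fun h1 v
  have h3v := DFunLike.congr_fun h3 v.1
  have h5 : ∀ w : TangentSpace I ((extChartAt I x).symm z.1), (coord I x z).snd w =
      inner ℝ z.2 (mfderiv I 𝓘(ℝ, Vec n) (extChartAt I x) ((extChartAt I x).symm z.1) w) := by
    intro w
    rw [← TangentBundle.continuousLinearMapAt_trivializationAt hs]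
    rw [coord_eq]
    rfl
  refine (congrArg (coord I x z).snd h1v.symm).trans ?_
  refine (h5 _).trans ?_
  exact congrArg (inner ℝ z.2) h3v

end Coordinates

/-! ### The canonical forms in canonical coordinates -/

section LocalForms

variable {n : ℕ} {H : Type*} [TopologicalSpace H] (I : ModelWithCorners ℝ (Vec n) H)
  {M : Type*} [TopologicalSpace M] [ChartedSpace H M] [IsManifold I ∞ M]

/-- Linear functionals on the coordinate space as 1-forms. -/
abbrev oneForm : (Vec n × Vec n →L[ℝ] ℝ) ≃ₗᵢ[ℝ] ((Vec n × Vec n) [⋀^Fin 1]→L[ℝ] ℝ) :=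
  ContinuousAlternatingMap.ofSubsingletonLIE (𝕜 := ℝ) (E := Vec n × Vec n) (F := ℝ) (0 : Fin 1)

theorem localCanonicalForm_eq (x : M) {z : Vec n × Vec n} (hz : z.1 ∈ (extChartAt I x).target) :
    localCanonicalForm I x z = ContinuousAlternatingMap.ofSubsingleton ℝ (Vec n × Vec n) ℝ 0
      ((innerSL ℝ z.2).comp (ContinuousLinearMap.fst ℝ (Vec n) (Vec n))) := by
  exact congrArg (ContinuousAlternatingMap.ofSubsingleton ℝ (Vec n × Vec n) ℝ 0)
    (canonicalForm_comp_mfderivWithin_coord I x hz)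

/-- In canonical coordinates `ω = ∑ dpᵢ ∧ dqᵢ`. -/
theorem localSymplecticForm_apply (x : M) {z : Vec n × Vec n}
    (hz : z.1 ∈ (extChartAt I x).target) (v : Fin 2 → Vec n × Vec n) :
    localSymplecticForm I x z v = inner ℝ (v 0).2 (v 1).1 - inner ℝ (v 1).2 (v 0).1 := by
  have hU := uniqueDiffOn_coordRange I z (coordRange_mem I x hz)
  have he : localCanonicalForm I x =ᶠ[𝓝[coordRange I] z]
      fun w => oneForm (n := n)
        ((innerSL ℝ w.2).comp (ContinuousLinearMap.fst ℝ (Vec n) (Vec n))) := by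
    filter_upwards [target_mem_nhdsWithin I x hz] with w hw
    rw [localCanonicalForm_eq I x hw]
    rfl
  rw [localSymplecticForm, he.extDerivWithin_eq_of_mem (coordRange_mem I x hz),
    extDerivWithin_apply _ hU]
  · refine (Fin.sum_univ_two _).trans ?_
    have hd : ∀ a : Vec n, fderivWithin ℝ (fun w : Vec n × Vec n => (inner ℝ w.2 a : ℝ))
        (coordRange I) z = ((innerSL ℝ a).comp (ContinuousLinearMap.snd ℝ (Vec n) (Vec n))) := by
      intro a
      have : (fun w : Vec n × Vec n => (inner ℝ w.2 a : ℝ)) =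
        ((innerSL ℝ a).comp (ContinuousLinearMap.snd ℝ (Vec n) (Vec n))) := by
        funext w; simp [real_inner_comm]
      rw [this, ContinuousLinearMap.fderivWithin _ hU]
    have hval : ∀ (w : Vec n × Vec n) (u : Fin 1 → Vec n × Vec n),
        (oneForm (n := n)
        ((innerSL ℝ w.2).comp (ContinuousLinearMap.fst ℝ (Vec n) (Vec n)))) u =
        inner ℝ w.2 (u 0).1 := fun _ _ => rfl
    simp only [hval, hd]
    have h0 : (inner ℝ (v 1).1 (v 0).2 : ℝ) = inner ℝ (v 0).2 (v 1).1 := real_inner_comm _ _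
    have h1 : (inner ℝ (v 0).1 (v 1).2 : ℝ) = inner ℝ (v 1).2 (v 0).1 := real_inner_comm _ _
    rw [← h0, ← h1]
    simp [Fin.removeNth, sub_eq_add_neg]
  · have : Differentiable ℝ (fun w : Vec n × Vec n =>
        oneForm (n := n)
        ((innerSL ℝ w.2).comp (ContinuousLinearMap.fst ℝ (Vec n) (Vec n)))) := by
      refine (oneForm (n := n)).differentiable.comp ?_
      exact ((innerSL ℝ).differentiable.comp differentiable_snd).clm_comp (differentiable_const _)
    exact (this z).differentiableWithinAt

/-- In canonical coordinates the Liouville measure is Lebesgue measure. -/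
theorem localVolumeForm_canonicalFrame (x : M) {z : Vec n × Vec n}
    (hz : z.1 ∈ (extChartAt I x).target) :
    localVolumeForm I x z (fun k => canonicalFrame n k) = 1 := by
  rw [localVolumeForm]
  have : (fun v => localSymplecticForm I x z v) = fun v : Fin 2 → Vec n × Vec n =>
      inner ℝ (v 0).2 (v 1).1 - inner ℝ (v 1).2 (v 0).1 :=
    funext fun v => localSymplecticForm_apply I x hz v
  change _ * wedgePow (fun v => localSymplecticForm I x z v) n _ = 1
  rw [this, wedgePow_canonicalFrame, inv_mul_cancel₀]
  exact_mod_cast Nat.factorial_ne_zero n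

variable {I} in
theorem StarHamiltonian.differentiableWithinAt_coord (h₀ : StarHamiltonian I M)
    (hs : h₀.IsSmooth) (x : M) {z : Vec n × Vec n} (hz : z.1 ∈ (extChartAt I x).target)
    (hp : z.2 ≠ 0) :
    DifferentiableWithinAt ℝ (fun w => h₀.toFun (coord I x w)) (coordRange I) z := by
  have h0 := coord_snd_ne_zero I x hz hp
  have h1 := contMDiffWithinAt_coord I x hz
  have hev : ∀ᶠ w in 𝓝[coordRange I] z, coord I x w ∈ {P : CotangentBundle I M | P.snd ≠ 0} := by
    have : ∀ᶠ w : Vec n × Vec n in 𝓝[coordRange I] z, w.2 ≠ 0 :=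
      nhdsWithin_le_nhds ((continuous_snd.tendsto z).eventually (isOpen_ne.mem_nhds hp))
    filter_upwards [this, target_mem_nhdsWithin I x hz] with w hw hw'
    exact coord_snd_ne_zero I x hw' hw
  have h2 := MDifferentiableWithinAt.comp_of_preimage_mem_nhdsWithin z
    ((hs _ h0).mdifferentiableWithinAt (by simp)) (h1.mdifferentiableWithinAt (by simp)) hev
  exact h2.differentiableWithinAt

/-- In canonical coordinates and the parametrization of `∂U` by unit covectors, `Ω` is
`H₀⁻ⁿ / n` times the surface measure of `ℝⁿ × Sⁿ⁻¹`. -/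
theorem wedge_normalForm_pulledOmega (hn : 1 ≤ n) (h₀ : StarHamiltonian I M) (hs : h₀.IsSmooth)
    (x : M) {z : Vec n × Vec n} (hz : z.1 ∈ (extChartAt I x).target) (hθ : ‖z.2‖ = 1) :
    wedge (normalForm z.2) (pulledOmega I h₀ x z) (fun k => canonicalFrame n k) =
      (n : ℝ)⁻¹ * ((h₀.toFun (coord I x z))⁻¹) ^ n := by
  have hp : z.2 ≠ 0 := by
    intro h
    rw [h, norm_zero] at hθ
    exact zero_ne_one hθ
  have hpos : 0 < h₀.toFun (coord I x z) := h₀.pos _ (coord_snd_ne_zero I x hz hp)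
  have hU := uniqueDiffOn_coordRange I z (coordRange_mem I x hz)
  have hg := ((h₀.differentiableWithinAt_coord hs x hz hp).inv hpos.ne').hasFDerivWithinAt
  set g' := fderivWithin ℝ (fun w => h₀.toFun (coord I x w))⁻¹ (coordRange I) z with hg'
  have hF : HasFDerivWithinAt (boundaryParam I h₀ x)
      ((ContinuousLinearMap.fst ℝ (Vec n) (Vec n)).prod
        ((h₀.toFun (coord I x z))⁻¹ • ContinuousLinearMap.snd ℝ (Vec n) (Vec n) +
          g'.smulRight z.2)) (coordRange I) z :=
    hasFDerivWithinAt_fst.prodMk (hg.smul hasFDerivWithinAt_snd)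
  have hD := hF.fderivWithin hU
  have hz' : (boundaryParam I h₀ x z).1 ∈ (extChartAt I x).target := hz
  have hα : ∀ v : Fin 1 → Vec n × Vec n, localCanonicalForm I x (boundaryParam I h₀ x z)
      (fun k => fderivWithin ℝ (boundaryParam I h₀ x) (coordRange I) z (v k)) =
      (h₀.toFun (coord I x z))⁻¹ * inner ℝ z.2 (v 0).1 := by
    intro v
    rw [localCanonicalForm_eq I x hz', hD]
    simp [boundaryParam]
  have hω : ∀ v : Fin 2 → Vec n × Vec n, localSymplecticForm I x (boundaryParam I h₀ x z)
      (fun k => fderivWithin ℝ (boundaryParam I h₀ x) (coordRange I) z (v k)) =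
      inner ℝ ((h₀.toFun (coord I x z))⁻¹ • (v 0).2 + g' (v 0) • z.2) (v 1).1 -
        inner ℝ ((h₀.toFun (coord I x z))⁻¹ • (v 1).2 + g' (v 1) • z.2) (v 0).1 := by
    intro v
    rw [localSymplecticForm_apply I x hz', hD]
    rfl
  obtain ⟨m, rfl⟩ : ∃ m, n = m + 1 := ⟨n - 1, by omega⟩
  have hΩ : pulledOmega I h₀ x z = fun v => ((m + 1).factorial : ℝ)⁻¹ * wedge
      (fun v : Fin 1 → Vec (m + 1) × Vec (m + 1) =>
        (h₀.toFun (coord I x z))⁻¹ * inner ℝ z.2 (v 0).1)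
      (wedgePow (fun v : Fin 2 → Vec (m + 1) × Vec (m + 1) =>
        inner ℝ ((h₀.toFun (coord I x z))⁻¹ • (v 0).2 + g' (v 0) • z.2) (v 1).1 -
          inner ℝ ((h₀.toFun (coord I x z))⁻¹ • (v 1).2 + g' (v 1) • z.2) (v 0).1) m) v := by
    funext v
    simp only [← hα, ← hω]
    rw [← wedgePow_comp (fun v => localSymplecticForm I x (boundaryParam I h₀ x z) v)]
    rfl
  have hc : ∀ {k l : ℕ} (a : (Fin k → Vec (m + 1) × Vec (m + 1)) → ℝ)
      (b : (Fin l → Vec (m + 1) × Vec (m + 1)) → ℝ) (c : ℝ) v,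
      wedge a (fun u => c * b u) v = c * wedge a b v := by
    intro k l a b c v
    simp only [wedge, Finset.mul_sum]
    exact Finset.sum_congr rfl fun σ _ => by ring
  rw [hΩ]
  refine (hc _ _ _ _).trans ?_
  refine (congrArg _
    (wedge_wedge_wedgePow_canonicalFrame z.2 hθ (inv_ne_zero hpos.ne') g')).trans ?_
  rw [Nat.factorial_succ]
  have := Nat.factorial_ne_zero m
  push_cast
  field_simp

end LocalForms

/-! ### Volume of a star body in polar coordinates -/

section PolarCoordinates

open Module

instance nullSingletonClass_volumeIoiPow (k : ℕ) :
    NullSingletonClass (Measure.volumeIoiPow k) where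
  measure_singleton a := by
    refine withDensity_absolutelyContinuous _ _ ?_
    rw [comap_subtype_coe_apply measurableSet_Ioi]
    simp

variable {E : Type*} [NormedAddCommGroup E] [NormedSpace ℝ E] [MeasurableSpace E] [BorelSpace E]
  [FiniteDimensional ℝ E] [Nontrivial E] (μ : Measure E) [μ.IsAddHaarMeasure]

theorem measure_sublevel_eq_lintegral_toSphere {g : E → ℝ} (hg : Continuous g)
    (hpos : ∀ x, x ≠ 0 → 0 < g x) (hhom : ∀ (t : ℝ) x, 0 < t → g (t • x) = t * g x) :
    μ {x | g x ≤ 1} = ∫⁻ θ : Metric.sphere (0 : E) 1,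
      ENNReal.ofReal ((finrank ℝ E : ℝ)⁻¹ * (g θ)⁻¹ ^ finrank ℝ E) ∂μ.toSphere := by
  have hm : MeasurableSet {x | g x ≤ 1} := (isClosed_le hg continuous_const).measurableSet
  have hS : MeasurableSet {w : Metric.sphere (0 : E) 1 × Ioi (0 : ℝ) | w.2.1 ≤ (g w.1)⁻¹} := by
    refine measurableSet_le (by fun_prop) ?_
    exact ((hg.measurable.comp measurable_subtype_coe).comp measurable_fst).inv
  have h1 : μ {x | g x ≤ 1} = μ.comap ((↑) : ({0}ᶜ : Set E) → E)
      ((homeomorphUnitSphereProd E) ⁻¹'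
        {w : Metric.sphere (0 : E) 1 × Ioi (0 : ℝ) | w.2.1 ≤ (g w.1)⁻¹}) := by
    rw [comap_subtype_coe_apply (measurableSet_singleton _).compl,
      ← measure_sdiff_null (measure_singleton (μ := μ) (0 : E))]
    congr 1
    ext x
    simp only [mem_sdiff, mem_ofPred_eq, mem_singleton_iff, mem_image, mem_preimage, Subtype.exists,
      mem_compl_iff, exists_and_right, exists_eq_right]
    have key : ∀ hx : x ≠ 0, ((homeomorphUnitSphereProd E ⟨x, hx⟩).2.1 ≤
        (g (homeomorphUnitSphereProd E ⟨x, hx⟩).1)⁻¹ ↔ g x ≤ 1) := by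
      intro hx
      rw [homeomorphUnitSphereProd_apply_snd_coe, homeomorphUnitSphereProd_apply_fst_coe]
      have hn : 0 < ‖x‖ := norm_pos_iff.2 hx
      have hgx := hpos x hx
      rw [hhom _ _ (inv_pos.2 hn), mul_inv, inv_inv, le_mul_iff_one_le_right hn,
        one_le_inv₀ hgx]
    constructor
    · rintro ⟨h, hx⟩
      exact ⟨hx, (key hx).2 h⟩
    · rintro ⟨hx, h⟩
      exact ⟨(key hx).1 h, hx⟩
  rw [h1, (μ.measurePreserving_homeomorphUnitSphereProd).measure_preimage hS.nullMeasurableSet,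
    Measure.prod_apply hS]
  refine lintegral_congr fun θ => ?_
  have hθ : 0 < (g θ)⁻¹ := inv_pos.2 (hpos _ (by
    intro h
    have := θ.2
    rw [h] at this
    simp at this))
  have h2 : (Prod.mk θ ⁻¹' {w : Metric.sphere (0 : E) 1 × Ioi (0 : ℝ) | w.2.1 ≤ (g w.1)⁻¹}) =
      Iic (⟨(g θ)⁻¹, hθ⟩ : Ioi (0 : ℝ)) := rfl
  have hd : 0 < finrank ℝ E := finrank_pos
  rw [h2, ← measure_congr Iio_ae_eq_Iic, Measure.volumeIoiPow_apply_Iio, Nat.sub_add_cancel hd,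
    Nat.cast_pred hd, sub_add_cancel, div_eq_inv_mul]

/-- The volume of a star body in polar coordinates. -/
theorem measureReal_sublevel_eq_integral_toSphere {g : E → ℝ} (hg : Continuous g)
    (hpos : ∀ x, x ≠ 0 → 0 < g x) (hhom : ∀ (t : ℝ) x, 0 < t → g (t • x) = t * g x) :
    μ.real {x | g x ≤ 1} = ∫ θ : Metric.sphere (0 : E) 1,
      (finrank ℝ E : ℝ)⁻¹ * (g θ)⁻¹ ^ finrank ℝ E ∂μ.toSphere := by
  have hθ : ∀ θ : Metric.sphere (0 : E) 1, 0 ≤ (g θ)⁻¹ := fun θ => inv_nonneg.2 (hpos _ (by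
    intro h
    have := θ.2
    rw [h] at this
    simp at this)).le
  rw [measureReal_def, measure_sublevel_eq_lintegral_toSphere μ hg hpos hhom,
    integral_eq_lintegral_of_nonneg_ae]
  · exact Filter.Eventually.of_forall fun θ => mul_nonneg (by positivity) (pow_nonneg (hθ θ) _)
  · refine Measurable.aestronglyMeasurable ?_
    exact (((hg.measurable.comp measurable_subtype_coe).inv).pow_const _).const_mul _

end PolarCoordinates

/-! ### Integration over the coordinate unit spheres -/

section SphereIntegral

variable {n : ℕ} {H : Type*} [TopologicalSpace H] (I : ModelWithCorners ℝ (Vec n) H)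
  {M : Type*} [TopologicalSpace M] [ChartedSpace H M] [IsManifold I ∞ M]
  [T2Space M] [CompactSpace M]

theorem chartPartition_tsupport_subset (x : M) :
    tsupport (chartPartition I M x) ⊆ (extChartAt I x).source := by
  rw [extChartAt_source]
  exact (SmoothPartitionOfUnity.exists_isSubordinate_chartAt_source I M).choose_spec x

theorem finite_support_chartPartition :
    {x : M | (chartPartition I M x : M → ℝ) ≠ 0}.Finite := by
  have := (chartPartition I M).locallyFinite.finite_nonempty_of_compact
  refine this.subset fun x hx => ?_
  exact Function.support_nonempty_iff.2 hx

/-- The weight of the preferred chart at `x`, as a function of coordinates. -/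
def chartWeight (x : M) (q : Vec n) : ℝ := chartPartition I M x ((extChartAt I x).symm q)

theorem continuousOn_chartWeight (x : M) :
    ContinuousOn (chartWeight I x) (extChartAt I x).target :=
  ((chartPartition I M x).contMDiff.continuous).comp_continuousOn (continuousOn_extChartAt_symm x)

theorem chartWeight_nonneg (x : M) (q : Vec n) : 0 ≤ chartWeight I x q :=
  (chartPartition I M).nonneg x _

omit [IsManifold I ∞ M] [T2Space M] [CompactSpace M] in
theorem measurableSet_target (x : M) : MeasurableSet (extChartAt I x).target := by
  rw [extChartAt_target]
  exact ((((chartAt H x).open_target).preimage I.continuous_symm).measurableSet).inter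
    I.isClosed_range.measurableSet

/-- A compact subset of the range of the preferred chart at `x` outside which `chartWeight I x`
vanishes. -/
def chartCore (x : M) : Set (Vec n) := extChartAt I x '' tsupport (chartPartition I M x)

theorem isCompact_chartCore (x : M) : IsCompact (chartCore I x) :=
  (isClosed_tsupport _).isCompact.image_of_continuousOn
    ((continuousOn_extChartAt x).mono (chartPartition_tsupport_subset I x))

theorem chartCore_subset_target (x : M) : chartCore I x ⊆ (extChartAt I x).target := by
  rintro _ ⟨y, hy, rfl⟩
  exact (extChartAt I x).map_source (chartPartition_tsupport_subset I x hy)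

theorem chartWeight_eq_zero (x : M) {q : Vec n} (hq : q ∈ (extChartAt I x).target)
    (hq' : q ∉ chartCore I x) : chartWeight I x q = 0 := by
  by_contra h
  exact hq' ⟨(extChartAt I x).symm q, subset_tsupport _ h, (extChartAt I x).right_inv hq⟩

/-- The measure `dq dθ` on the unit sphere bundle in the coordinates of the preferred chart. -/
def chartSphereMeasure (x : M) : Measure (Vec n × Metric.sphere (0 : Vec n) 1) :=
  (volume.restrict (extChartAt I x).target).prod (volume : Measure (Vec n)).toSphere

omit [IsManifold I ∞ M] [T2Space M] [CompactSpace M] in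
theorem chartSphereMeasure_eq (x : M) : chartSphereMeasure I x =
    ((volume : Measure (Vec n)).prod (volume : Measure (Vec n)).toSphere).restrict
      ((extChartAt I x).target ×ˢ univ) := by
  rw [chartSphereMeasure, ← Measure.prod_restrict, Measure.restrict_univ]

/-- The integrand of `sphereIntegral` in the coordinates of the preferred chart at `x`. -/
def sphereIntegrand (G : CotangentBundle I M → ℝ) (x : M)
    (w : Vec n × Metric.sphere (0 : Vec n) 1) : ℝ :=
  chartWeight I x w.1 * G (coord I x (w.1, (w.2 : Vec n)))

/-- The integral of a function over the coordinate unit spheres in the fibres, through the partition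
of unity. For a function `G` that is homogeneous of degree `-n` in the fibres, it is `n` times the
integral of `G Ω` over `∂U`, for any model body `U`. -/
def sphereIntegral (G : CotangentBundle I M → ℝ) : ℝ :=
  ∑ᶠ x : M, ∫ w, sphereIntegrand I G x w ∂(chartSphereMeasure I x)

theorem sphere_ne_zero (θ : Metric.sphere (0 : Vec n) 1) : (θ : Vec n) ≠ 0 :=
  Metric.ne_of_mem_sphere θ.2 one_ne_zero

variable {I}

theorem continuousOn_sphereIntegrand {G : CotangentBundle I M → ℝ}
    (hG : ContinuousOn G {P | P.snd ≠ 0}) (x : M) :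
    ContinuousOn (sphereIntegrand I G x) ((extChartAt I x).target ×ˢ univ) := by
  refine ContinuousOn.mul ((continuousOn_chartWeight I x).comp continuousOn_fst fun w hw => hw.1) ?_
  refine hG.comp ((continuousOn_coord I x).comp (f := fun w : Vec n × Metric.sphere (0 : Vec n) 1 =>
    (w.1, (w.2 : Vec n))) (by fun_prop) fun w hw => ⟨hw.1, mem_univ _⟩) ?_
  intro w hw
  exact coord_snd_ne_zero I x hw.1 (sphere_ne_zero w.2)

/-- The integrand is continuous on a compact set and vanishes outside it. -/
theorem integrable_sphereIntegrand {G : CotangentBundle I M → ℝ}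
    (hG : ContinuousOn G {P | P.snd ≠ 0}) (x : M) :
    Integrable (sphereIntegrand I G x) (chartSphereMeasure I x) := by
  rw [chartSphereMeasure_eq]
  have hK : IsCompact (chartCore I x ×ˢ (univ : Set (Metric.sphere (0 : Vec n) 1))) :=
    (isCompact_chartCore I x).prod isCompact_univ
  have h1 : IntegrableOn (sphereIntegrand I G x) (chartCore I x ×ˢ univ)
      ((volume : Measure (Vec n)).prod (volume : Measure (Vec n)).toSphere) :=
    ((continuousOn_sphereIntegrand hG x).mono
      (prod_mono (chartCore_subset_target I x) subset_rfl)).integrableOn_compact hK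
  refine h1.of_forall_sdiff_eq_zero ((measurableSet_target I x).prod MeasurableSet.univ) ?_
  rintro w ⟨hw, hw'⟩
  rw [sphereIntegrand, chartWeight_eq_zero I x hw.1 (fun h => hw' ⟨h, mem_univ _⟩), zero_mul]

theorem sphereIntegral_eq_sum (G : CotangentBundle I M → ℝ) : sphereIntegral I G =
    ∑ x ∈ (finite_support_chartPartition (M := M) I).toFinset,
      ∫ w, sphereIntegrand I G x w ∂(chartSphereMeasure I x) := by
  refine finsum_eq_sum_of_support_subset _ fun x hx => ?_
  simp only [Finite.coe_toFinset, mem_ofPred_eq]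
  intro h
  apply hx
  have : ∀ w, sphereIntegrand I G x w = 0 := fun w => by
    simp [sphereIntegrand, chartWeight, h]
  simp [this]

theorem sphereIntegral_const_mul (c : ℝ) (G : CotangentBundle I M → ℝ) :
    sphereIntegral I (fun P => c * G P) = c * sphereIntegral I G := by
  rw [sphereIntegral_eq_sum, sphereIntegral_eq_sum, Finset.mul_sum]
  refine Finset.sum_congr rfl fun x _ => ?_
  rw [← integral_const_mul]
  refine integral_congr_ae (Filter.Eventually.of_forall fun w => ?_)
  simp only [sphereIntegrand]
  ring

theorem sphereIntegral_sub {F G : CotangentBundle I M → ℝ} (hF : ContinuousOn F {P | P.snd ≠ 0})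
    (hG : ContinuousOn G {P | P.snd ≠ 0}) :
    sphereIntegral I (fun P => F P - G P) = sphereIntegral I F - sphereIntegral I G := by
  simp only [sphereIntegral_eq_sum, ← Finset.sum_sub_distrib]
  refine Finset.sum_congr rfl fun x _ => ?_
  rw [← integral_sub (integrable_sphereIntegrand hF x) (integrable_sphereIntegrand hG x)]
  refine integral_congr_ae (Filter.Eventually.of_forall fun w => ?_)
  simp only [sphereIntegrand]
  ring

theorem sphereIntegral_sum {ι : Type*} (s : Finset ι) {F : ι → CotangentBundle I M → ℝ}
    (hF : ∀ i ∈ s, ContinuousOn (F i) {P | P.snd ≠ 0}) :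
    sphereIntegral I (fun P => ∑ i ∈ s, F i P) = ∑ i ∈ s, sphereIntegral I (F i) := by
  simp only [sphereIntegral_eq_sum]
  rw [Finset.sum_comm]
  refine Finset.sum_congr rfl fun x _ => ?_
  rw [← integral_finsetSum _ fun i hi => integrable_sphereIntegrand (hF i hi) x]
  refine integral_congr_ae (Filter.Eventually.of_forall fun w => ?_)
  simp only [sphereIntegrand, Finset.mul_sum]

theorem sphereIntegrand_nonneg {G : CotangentBundle I M → ℝ} (hG0 : ∀ P, P.snd ≠ 0 → 0 ≤ G P)
    (x : M) : 0 ≤ᵐ[chartSphereMeasure I x] sphereIntegrand I G x := by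
  rw [chartSphereMeasure_eq]
  refine (ae_restrict_mem ((measurableSet_target I x).prod MeasurableSet.univ)).mono fun w hw => ?_
  exact mul_nonneg (chartWeight_nonneg I x _)
    (hG0 _ (coord_snd_ne_zero I x hw.1 (sphere_ne_zero w.2)))

theorem sphereIntegral_nonneg {G : CotangentBundle I M → ℝ} (hG0 : ∀ P, P.snd ≠ 0 → 0 ≤ G P) :
    0 ≤ sphereIntegral I G := by
  rw [sphereIntegral_eq_sum]
  exact Finset.sum_nonneg fun x _ => integral_nonneg_of_ae (sphereIntegrand_nonneg hG0 x)

/-- A continuous nonnegative function whose integral over the coordinate spheres vanishes has a zero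
on every ray in every fibre. -/
theorem exists_scale_eq_zero_of_sphereIntegral_eq_zero {G : CotangentBundle I M → ℝ}
    (hG : ContinuousOn G {P | P.snd ≠ 0}) (hG0 : ∀ P, P.snd ≠ 0 → 0 ≤ G P)
    (h : sphereIntegral I G = 0) (P : CotangentBundle I M) (hP : P.snd ≠ 0) :
    ∃ r : ℝ, 0 < r ∧ G (scale I r P) = 0 := by
  obtain ⟨x, hx⟩ := (chartPartition I M).exists_pos_of_mem (mem_univ P.proj)
  have hPs : P.proj ∈ (extChartAt I x).source :=
    chartPartition_tsupport_subset I x (subset_tsupport _ hx.ne')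
  obtain ⟨p, hp⟩ := exists_coord_eq I x P hPs
  have hq : extChartAt I x P.proj ∈ (extChartAt I x).target := (extChartAt I x).map_source hPs
  have hp0 : p ≠ 0 := by
    rintro rfl
    apply hP
    rw [hp, show ((extChartAt I x P.proj, (0 : Vec n)) : Vec n × Vec n) =
      (extChartAt I x P.proj, (0 : ℝ) • (0 : Vec n)) by rw [zero_smul], coord_smul]
    exact zero_smul ℝ _
  rw [sphereIntegral_eq_sum, Finset.sum_eq_zero_iff_of_nonneg
    fun x _ => integral_nonneg_of_ae (sphereIntegrand_nonneg hG0 x)] at h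
  have h1 := h x (by
    simp only [Finite.mem_toFinset, mem_ofPred_eq]
    intro h0
    rw [h0] at hx
    exact lt_irrefl _ hx)
  rw [integral_eq_zero_iff_of_nonneg_ae (sphereIntegrand_nonneg hG0 x)
    (integrable_sphereIntegrand hG x), chartSphereMeasure_eq] at h1
  have h2 := Measure.eqOn_of_ae_eq h1 (continuousOn_sphereIntegrand hG x) continuousOn_const (by
    rw [interior_prod_eq, interior_univ, closure_prod_eq, closure_univ]
    exact prod_mono extChartAt_target_subset_closure_interior subset_rfl)
  have hn : 0 < ‖p‖ := norm_pos_iff.2 hp0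
  let θ : Metric.sphere (0 : Vec n) 1 := ⟨‖p‖⁻¹ • p, by
    rw [mem_sphere_zero_iff_norm, norm_smul, norm_inv, norm_norm, inv_mul_cancel₀ hn.ne']⟩
  -- The ray through `P` meets the coordinate unit sphere in the covector with coordinates `θ`.
  have h3 := h2 (x := (extChartAt I x P.proj, θ)) ⟨hq, mem_univ _⟩
  refine ⟨‖p‖⁻¹, inv_pos.2 hn, ?_⟩
  have h4 : chartWeight I x (extChartAt I x P.proj) ≠ 0 := by
    rw [chartWeight, (extChartAt I x).left_inv hPs]
    exact hx.ne'
  have h5 := (mul_eq_zero.1 h3).resolve_left h4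
  rw [← h5]
  congr 1
  conv_lhs => rw [hp]
  rw [← coord_smul]

end SphereIntegral

/-! ### The volumes as integrals over spheres -/

section Volumes

variable {n : ℕ} {H : Type*} [TopologicalSpace H] {I : ModelWithCorners ℝ (Vec n) H}
  {M : Type*} [TopologicalSpace M] [ChartedSpace H M] [IsManifold I ∞ M]
  [T2Space M] [CompactSpace M]

omit [T2Space M] [CompactSpace M] in
theorem StarHamiltonian.continuousOn_inv (h : StarHamiltonian I M) :
    ContinuousOn (fun P => (h.toFun P)⁻¹) {P | P.snd ≠ 0} :=
  h.continuous.continuousOn.inv₀ fun P hP => (h.pos P hP).ne'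

theorem dualMixedVolume_eq_sphereIntegral (hn : 1 ≤ n) (U : StarBody I M)
    (hU : (U.hamiltonian I).IsSmooth) (A : Fin n → StarBody I M) :
    dualMixedVolume I U A =
      sphereIntegral I (fun P => (n : ℝ)⁻¹ * ∏ i, (((A i).hamiltonian I).toFun P)⁻¹) := by
  have hG : ContinuousOn (fun P : CotangentBundle I M =>
      (n : ℝ)⁻¹ * ∏ i, (((A i).hamiltonian I).toFun P)⁻¹) {P | P.snd ≠ 0} :=
    continuousOn_const.mul (continuousOn_finsetProd _ fun i _ =>
      ((A i).hamiltonian I).continuousOn_inv)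
  rw [dualMixedVolume, boundaryIntegral, sphereIntegral]
  refine finsum_congr fun x => ?_
  have hi := integrable_sphereIntegrand hG x
  rw [chartSphereMeasure] at hi ⊢
  rw [integral_prod _ hi]
  refine setIntegral_congr_fun (measurableSet_target I x) fun q hq => ?_
  refine integral_congr_ae (Filter.Eventually.of_forall fun θ => ?_)
  have hpos : 0 < (U.hamiltonian I).toFun (coord I x (q, (θ : Vec n))) :=
    (U.hamiltonian I).pos _ (coord_snd_ne_zero I x hq (sphere_ne_zero θ))
  have hw := wedge_normalForm_pulledOmega I hn (U.hamiltonian I) hU x (z := (q, (θ : Vec n))) hq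
    (mem_sphere_zero_iff_norm.1 θ.2)
  have hr : ∀ i, (A i).radial I
      (coord I x (boundaryParam I (U.hamiltonian I) x (q, (θ : Vec n)))) =
      (U.hamiltonian I).toFun (coord I x (q, (θ : Vec n))) *
        (((A i).hamiltonian I).toFun (coord I x (q, (θ : Vec n))))⁻¹ := by
    intro i
    rw [StarBody.radial, boundaryParam, coord_smul,
      ((A i).hamiltonian I).homogeneous _ _ (inv_pos.2 hpos), one_div, mul_inv, inv_inv]
  simp only [hr, Finset.prod_mul_distrib, Finset.prod_const, Finset.card_univ, Fintype.card_fin]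
  simp only at hw
  rw [hw, sphereIntegrand, coord_proj, chartWeight]
  have := pow_ne_zero n hpos.ne'
  rw [inv_pow]
  field_simp

/-- Star bodies are compact, because their Hamiltonians are proper. -/
theorem integrableOn_chartWeight_mul_indicator (A : StarBody I M) (x : M) :
    IntegrableOn (fun z : Vec n × Vec n =>
      chartWeight I x z.1 * A.carrier.indicator (fun _ => (1 : ℝ)) (coord I x z))
      ((extChartAt I x).target ×ˢ univ) := by
  set Φ := extChartAt (cotangentModel I) (⟨x, 0⟩ : CotangentBundle I M) with hΦ
  let ψ : CotangentBundle I M → Vec n × Vec n := fun P =>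
    ((Φ P).1, (InnerProductSpace.toDual ℝ (Vec n)).symm (Φ P).2)
  have hA : IsCompact A.carrier := by
    have : A.carrier = (A.hamiltonian I).toFun ⁻¹' Icc 0 1 := by
      rw [A.carrier_eq]
      ext P
      simp [(A.hamiltonian I).nonneg P]
    rw [this]
    exact (A.hamiltonian I).proper.isCompact_preimage isCompact_Icc
  -- The support of the integrand is the image of a compact subset of the cotangent bundle.
  have hC : IsCompact (A.carrier ∩ {P | P.proj ∈ tsupport (chartPartition I M x)}) :=
    hA.inter_right ((isClosed_tsupport _).preimage (FiberBundle.continuous_proj _ _))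
  have hCs : A.carrier ∩ {P | P.proj ∈ tsupport (chartPartition I M x)} ⊆ Φ.source := by
    rw [hΦ, extChartAt_cotangent_source]
    exact fun P hP => chartPartition_tsupport_subset I x hP.2
  have hψ : ContinuousOn ψ Φ.source := by
    have h := continuousOn_extChartAt (I := cotangentModel I) (⟨x, 0⟩ : CotangentBundle I M)
    exact (continuous_fst.comp_continuousOn h).prodMk
      ((InnerProductSpace.toDual ℝ (Vec n)).symm.continuous.comp_continuousOn
        (continuous_snd.comp_continuousOn h))
  have hcoordψ : ∀ P ∈ Φ.source, coord I x (ψ P) = P := by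
    intro P hP
    have h1 : innerSL ℝ ((InnerProductSpace.toDual ℝ (Vec n)).symm (Φ P).2) = (Φ P).2 :=
      (InnerProductSpace.toDual ℝ (Vec n)).apply_symm_apply _
    simp only [coord, ψ, h1]
    exact Φ.left_inv hP
  have hψcoord : ∀ z ∈ (extChartAt I x).target ×ˢ (univ : Set (Vec n)), ψ (coord I x z) = z := by
    intro z hz
    have h1 : Φ (coord I x z) = (z.1, innerSL ℝ z.2) :=
      Φ.right_inv (by rw [hΦ, extChartAt_cotangent_target]; exact ⟨hz.1, mem_univ _⟩)
    refine Prod.ext ?_ ?_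
    · simp only [ψ, h1]
    · simp only [ψ, h1]
      exact (InnerProductSpace.toDual ℝ (Vec n)).symm_apply_apply _
  have hK := hC.image_of_continuousOn (hψ.mono hCs)
  have hKt : ψ '' (A.carrier ∩ {P | P.proj ∈ tsupport (chartPartition I M x)}) ⊆
      (extChartAt I x).target ×ˢ univ := by
    rintro _ ⟨P, hP, rfl⟩
    refine ⟨?_, mem_univ _⟩
    have h := Φ.map_source (hCs hP)
    rw [hΦ, extChartAt_cotangent_target] at h
    exact h.1
  have h1 : IntegrableOn (fun z : Vec n × Vec n =>
      chartWeight I x z.1 * A.carrier.indicator (fun _ => (1 : ℝ)) (coord I x z))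
      (ψ '' (A.carrier ∩ {P | P.proj ∈ tsupport (chartPartition I M x)})) := by
    refine ContinuousOn.integrableOn_compact hK ?_
    refine ContinuousOn.congr (f := fun z : Vec n × Vec n => chartWeight I x z.1)
      ((continuousOn_chartWeight I x).comp continuousOn_fst fun z hz => (hKt hz).1) ?_
    rintro _ ⟨P, hP, rfl⟩
    simp only
    rw [hcoordψ P (hCs hP), indicator_of_mem hP.1, mul_one]
  refine h1.of_forall_sdiff_eq_zero ((measurableSet_target I x).prod MeasurableSet.univ) ?_
  rintro z ⟨hz, hz'⟩
  by_cases hzA : coord I x z ∈ A.carrier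
  · have : chartWeight I x z.1 = 0 := by
      by_contra h
      refine hz' ⟨coord I x z, ⟨hzA, subset_tsupport _ ?_⟩, hψcoord z hz⟩
      exact h
    rw [this, zero_mul]
  · rw [indicator_of_notMem hzA, mul_zero]

theorem symplecticVolume_eq_sphereIntegral (hn : 1 ≤ n) (A : StarBody I M) :
    symplecticVolume I A.carrier =
      sphereIntegral I (fun P => (n : ℝ)⁻¹ * ((A.hamiltonian I).toFun P)⁻¹ ^ n) := by
  have hG : ContinuousOn (fun P : CotangentBundle I M =>
      (n : ℝ)⁻¹ * ((A.hamiltonian I).toFun P)⁻¹ ^ n) {P | P.snd ≠ 0} :=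
    continuousOn_const.mul ((A.hamiltonian I).continuousOn_inv.pow n)
  have : Nonempty (Fin n) := ⟨⟨0, hn⟩⟩
  rw [symplecticVolume, liouvilleIntegral, sphereIntegral]
  refine finsum_congr fun x => ?_
  have hi := integrable_sphereIntegrand hG x
  rw [chartSphereMeasure] at hi ⊢
  rw [integral_prod _ hi]
  have h1 : ∫ z in (extChartAt I x).target ×ˢ (univ : Set (Vec n)),
      chartPartition I M x (coord I x z).proj * A.carrier.indicator (fun _ => 1) (coord I x z) *
        localVolumeForm I x z (fun k => canonicalFrame n k) =
      ∫ z in (extChartAt I x).target ×ˢ (univ : Set (Vec n)),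
        chartWeight I x z.1 * A.carrier.indicator (fun _ => (1 : ℝ)) (coord I x z) := by
    refine setIntegral_congr_fun ((measurableSet_target I x).prod MeasurableSet.univ) fun z hz => ?_
    rw [localVolumeForm_canonicalFrame I x hz.1, mul_one, coord_proj, chartWeight]
  rw [h1]
  have hi' := integrableOn_chartWeight_mul_indicator A x
  rw [Measure.volume_eq_prod] at hi' ⊢
  rw [setIntegral_prod _ hi']
  refine setIntegral_congr_fun (measurableSet_target I x) fun q hq => ?_
  simp only [Measure.restrict_univ, sphereIntegrand]
  rw [integral_const_mul, integral_const_mul]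
  congr 1
  set g : Vec n → ℝ := fun p => (A.hamiltonian I).toFun (coord I x (q, p)) with hg
  have hgc : Continuous g := by
    refine (A.hamiltonian I).continuous.comp ?_
    rw [← continuousOn_univ]
    exact (continuousOn_coord I x).comp (by fun_prop) fun p _ => ⟨hq, mem_univ _⟩
  have hgpos : ∀ p, p ≠ 0 → 0 < g p := fun p hp =>
    (A.hamiltonian I).pos _ (coord_snd_ne_zero I x hq hp)
  have hghom : ∀ (t : ℝ) p, 0 < t → g (t • p) = t * g p := by
    intro t p ht
    simp only [hg]
    rw [coord_smul, (A.hamiltonian I).homogeneous _ _ ht]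
  have h2 := measureReal_sublevel_eq_integral_toSphere (volume : Measure (Vec n)) hgc hgpos hghom
  rw [finrank_euclideanSpace_fin] at h2
  rw [← h2]
  have h3 : (fun p => A.carrier.indicator (fun _ => (1 : ℝ)) (coord I x (q, p))) =
      {p | g p ≤ 1}.indicator (fun _ => (1 : ℝ)) := by
    funext p
    simp only [indicator, A.carrier_eq, mem_ofPred_eq, hg]
  rw [h3, integral_indicator_const _ (isClosed_le hgc continuous_const).measurableSet, smul_eq_mul,
    mul_one]

end Volumes

/-! ### The inequality between the geometric and the arithmetic mean -/

section ArithGeom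

variable {n : ℕ}

theorem prod_le_sum_inv_mul_pow (hn : 1 ≤ n) (u : Fin n → ℝ) (hu : ∀ i, 0 ≤ u i) :
    ∏ i, u i ≤ ∑ i, (n : ℝ)⁻¹ * u i ^ n := by
  have hn0 : n ≠ 0 := by omega
  have h := Real.geom_mean_le_arith_mean_weighted Finset.univ (fun _ : Fin n => (n : ℝ)⁻¹)
    (fun i => u i ^ n) (fun i _ => by positivity) (by simp [hn0]) (fun i _ => pow_nonneg (hu i) n)
  simpa only [Real.pow_rpow_inv_natCast (hu _) hn0] using h

theorem eq_of_prod_eq_sum_inv_mul_pow (hn : 1 ≤ n) (u : Fin n → ℝ) (hu : ∀ i, 0 ≤ u i)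
    (h : ∏ i, u i = ∑ i, (n : ℝ)⁻¹ * u i ^ n) (i j : Fin n) : u i = u j := by
  have hn0 : n ≠ 0 := by omega
  have h1 := (Real.geom_mean_eq_arith_mean_weighted_iff_of_pos Finset.univ
    (fun _ : Fin n => (n : ℝ)⁻¹) (fun i => u i ^ n) (fun i _ => by positivity) (by simp [hn0])
    (fun i _ => pow_nonneg (hu i) n)).1
    (by simpa only [Real.pow_rpow_inv_natCast (hu _) hn0] using h)
  exact (pow_left_inj₀ (hu i) (hu j) hn0).1 (h1 i (Finset.mem_univ _) j (Finset.mem_univ _))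

end ArithGeom

/-! ### Dilations of star bodies -/

section Dilations

variable {n : ℕ} {H : Type*} [TopologicalSpace H] {I : ModelWithCorners ℝ (Vec n) H}
  {M : Type*} [TopologicalSpace M] [ChartedSpace H M] [IsManifold I ∞ M]

omit [IsManifold I ∞ M] in
theorem scale_scale (s t : ℝ) (P : CotangentBundle I M) :
    scale I s (scale I t P) = scale I (s * t) P := by
  rw [scale, scale, scale]
  congr 1
  exact smul_smul _ _ _

omit [IsManifold I ∞ M] in
theorem scale_one (P : CotangentBundle I M) : scale I 1 P = P := by
  simp only [scale, one_smul]

omit [IsManifold I ∞ M] in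
theorem mem_dilate_iff {t : ℝ} (ht : 0 < t) (S : Set (CotangentBundle I M))
    (P : CotangentBundle I M) : P ∈ dilate I t S ↔ scale I t⁻¹ P ∈ S := by
  constructor
  · rintro ⟨Q, hQ, rfl⟩
    rwa [scale_scale, inv_mul_cancel₀ ht.ne', scale_one]
  · intro h
    exact ⟨_, h, by rw [scale_scale, mul_inv_cancel₀ ht.ne', scale_one]⟩

theorem StarHamiltonian.eq_zero_of_snd_eq_zero (h : StarHamiltonian I M) {P : CotangentBundle I M}
    (hP : P.snd = 0) : h.toFun P = 0 := by
  have h1 : scale I 2 P = P := by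
    rw [scale, hP, smul_zero, ← hP]
  have h2 := h.homogeneous 2 P two_pos
  rw [h1] at h2
  linarith

/-- Star bodies are dilations of each other if and only if their Hamiltonians are proportional. -/
theorem StarBody.carrier_eq_dilate_iff (A B : StarBody I M) {t : ℝ} (ht : 0 < t) :
    A.carrier = dilate I t B.carrier ↔
      ∀ P, (A.hamiltonian I).toFun P = t⁻¹ * (B.hamiltonian I).toFun P := by
  constructor
  · intro h
    have key : ∀ P, (A.hamiltonian I).toFun P ≤ 1 ↔ t⁻¹ * (B.hamiltonian I).toFun P ≤ 1 := by
      intro P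
      have h1 : P ∈ A.carrier ↔ scale I t⁻¹ P ∈ B.carrier := by rw [h, mem_dilate_iff ht]
      rwa [A.carrier_eq, B.carrier_eq, mem_ofPred_eq, mem_ofPred_eq,
        (B.hamiltonian I).homogeneous _ _ (inv_pos.2 ht)] at h1
    have key2 : ∀ P s, 0 < s → ((A.hamiltonian I).toFun P ≤ s ↔
        t⁻¹ * (B.hamiltonian I).toFun P ≤ s) := by
      intro P s hs
      have h1 := key (scale I s⁻¹ P)
      rw [(A.hamiltonian I).homogeneous _ _ (inv_pos.2 hs),
        (B.hamiltonian I).homogeneous _ _ (inv_pos.2 hs), mul_left_comm, inv_mul_le_iff₀ hs,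
        inv_mul_le_iff₀ hs, mul_one] at h1
      exact h1
    intro P
    have hA := (A.hamiltonian I).nonneg P
    have hB := mul_nonneg (inv_pos.2 ht).le ((B.hamiltonian I).nonneg P)
    refine le_antisymm (le_of_forall_pos_le_add fun ε hε => ?_)
      (le_of_forall_pos_le_add fun ε hε => ?_)
    · exact (key2 P _ (by linarith)).2 (by linarith)
    · exact (key2 P _ (by linarith)).1 (by linarith)
  · intro h
    ext P
    rw [mem_dilate_iff ht, A.carrier_eq, B.carrier_eq, mem_ofPred_eq, mem_ofPred_eq, h P,
      (B.hamiltonian I).homogeneous _ _ (inv_pos.2 ht)]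

end Dilations

/-! ### The inequality for dual mixed volumes -/

section Inequality

variable {n : ℕ} {H : Type*} [TopologicalSpace H] {I : ModelWithCorners ℝ (Vec n) H}
  {M : Type*} [TopologicalSpace M] [ChartedSpace H M] [IsManifold I ∞ M]
  [T2Space M] [CompactSpace M]

theorem sphereIntegral_of_isEmpty [IsEmpty M] (G : CotangentBundle I M → ℝ) :
    sphereIntegral I G = 0 := finsum_of_isEmpty _

omit [T2Space M] [CompactSpace M] in
theorem exists_snd_ne_zero (hn : 1 ≤ n) [Nonempty M] : ∃ P : CotangentBundle I M, P.snd ≠ 0 := by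
  obtain ⟨x⟩ := ‹Nonempty M›
  refine ⟨coord I x (extChartAt I x x, EuclideanSpace.single ⟨0, hn⟩ 1),
    coord_snd_ne_zero I x (mem_extChartAt_target x) ?_⟩
  intro h
  have := congrArg (fun v : Vec n => v ⟨0, hn⟩) h
  simp at this

theorem symplecticVolume_pos (hn : 1 ≤ n) [Nonempty M] (A : StarBody I M) :
    0 < symplecticVolume I A.carrier := by
  have hpos : ∀ P : CotangentBundle I M, P.snd ≠ 0 →
      0 < (n : ℝ)⁻¹ * ((A.hamiltonian I).toFun P)⁻¹ ^ n := by
    intro P hP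
    have := (A.hamiltonian I).pos P hP
    positivity
  rw [symplecticVolume_eq_sphereIntegral hn]
  refine lt_of_le_of_ne (sphereIntegral_nonneg fun P hP => (hpos P hP).le) fun h => ?_
  obtain ⟨P, hP⟩ := exists_snd_ne_zero (I := I) (M := M) hn
  obtain ⟨r, hr, h0⟩ := exists_scale_eq_zero_of_sphereIntegral_eq_zero
    (continuousOn_const.mul ((A.hamiltonian I).continuousOn_inv.pow n))
    (fun P hP => (hpos P hP).le) h.symm P hP
  exact (hpos (scale I r P) (smul_ne_zero hr.ne' hP)).ne' h0

/-- The deficit of the arithmetic-geometric mean inequality for the numbers `(cᵢ Hᵢ)⁻¹`. -/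
def meanDeficit (A : Fin n → StarBody I M) (c : Fin n → ℝ) (P : CotangentBundle I M) : ℝ :=
  ∑ i, (n : ℝ)⁻¹ * ((c i)⁻¹ * (((A i).hamiltonian I).toFun P)⁻¹) ^ n -
    ∏ i, ((c i)⁻¹ * (((A i).hamiltonian I).toFun P)⁻¹)

omit [T2Space M] [CompactSpace M] in
theorem meanDeficit_nonneg (hn : 1 ≤ n) (A : Fin n → StarBody I M) {c : Fin n → ℝ}
    (hc : ∀ i, 0 < c i) (P : CotangentBundle I M) : 0 ≤ meanDeficit A c P :=
  sub_nonneg.2 (prod_le_sum_inv_mul_pow hn _ fun i =>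
    mul_nonneg (inv_pos.2 (hc i)).le (inv_nonneg.2 (((A i).hamiltonian I).nonneg P)))

omit [T2Space M] [CompactSpace M] in
theorem continuousOn_meanDeficit (A : Fin n → StarBody I M) (c : Fin n → ℝ) :
    ContinuousOn (meanDeficit A c) {P | P.snd ≠ 0} := by
  have h : ∀ i, ContinuousOn (fun P => (c i)⁻¹ * (((A i).hamiltonian I).toFun P)⁻¹)
      {P | P.snd ≠ 0} := fun i => continuousOn_const.mul ((A i).hamiltonian I).continuousOn_inv
  exact (continuousOn_finsetSum _ fun i _ => continuousOn_const.mul ((h i).pow n)).sub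
    (continuousOn_finsetProd _ fun i _ => h i)

/-- If the `cᵢ` are the `n`-th roots of the volumes, the integral of the deficit compares the dual
mixed volume with the product of the `cᵢ`. -/
theorem sphereIntegral_meanDeficit (hn : 1 ≤ n) (U : StarBody I M)
    (hU : (U.hamiltonian I).IsSmooth) (A : Fin n → StarBody I M) {c : Fin n → ℝ}
    (hc : ∀ i, 0 < c i) (hcV : ∀ i, c i ^ n = symplecticVolume I (A i).carrier) :
    sphereIntegral I (meanDeficit A c) = n * (1 - (∏ i, c i)⁻¹ * dualMixedVolume I U A) := by
  have hn0 : (n : ℝ) ≠ 0 := by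
    have : n ≠ 0 := by omega
    exact_mod_cast this
  have h : ∀ i, ContinuousOn (fun P => (c i)⁻¹ * (((A i).hamiltonian I).toFun P)⁻¹)
      {P | P.snd ≠ 0} := fun i => continuousOn_const.mul ((A i).hamiltonian I).continuousOn_inv
  have h1 : sphereIntegral I (meanDeficit A c) =
      sphereIntegral I (fun P : CotangentBundle I M =>
        ∑ i, (n : ℝ)⁻¹ * ((c i)⁻¹ * (((A i).hamiltonian I).toFun P)⁻¹) ^ n) -
      sphereIntegral I (fun P : CotangentBundle I M =>
        ∏ i, ((c i)⁻¹ * (((A i).hamiltonian I).toFun P)⁻¹)) :=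
    sphereIntegral_sub (continuousOn_finsetSum _ fun i _ => continuousOn_const.mul ((h i).pow n))
      (continuousOn_finsetProd _ fun i _ => h i)
  have h2 : ∀ i, sphereIntegral I (fun P : CotangentBundle I M =>
      (n : ℝ)⁻¹ * ((c i)⁻¹ * (((A i).hamiltonian I).toFun P)⁻¹) ^ n) = 1 := by
    intro i
    have : (fun P : CotangentBundle I M =>
        (n : ℝ)⁻¹ * ((c i)⁻¹ * (((A i).hamiltonian I).toFun P)⁻¹) ^ n) =
        fun P => (c i ^ n)⁻¹ * ((n : ℝ)⁻¹ * (((A i).hamiltonian I).toFun P)⁻¹ ^ n) := by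
      funext P
      rw [mul_pow, inv_pow]
      ring
    rw [this, sphereIntegral_const_mul, ← symplecticVolume_eq_sphereIntegral hn, ← hcV,
      inv_mul_cancel₀ (pow_ne_zero n (hc i).ne')]
  have h3 : (fun P : CotangentBundle I M =>
      ∏ i, ((c i)⁻¹ * (((A i).hamiltonian I).toFun P)⁻¹)) =
      fun P => ((∏ i, c i)⁻¹ * n) * ((n : ℝ)⁻¹ * ∏ i, (((A i).hamiltonian I).toFun P)⁻¹) := by
    funext P
    rw [Finset.prod_mul_distrib, Finset.prod_inv_distrib c]
    field_simp
  rw [h1, h3, sphereIntegral_const_mul, ← dualMixedVolume_eq_sphereIntegral hn U hU,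
    sphereIntegral_sum (F := fun i (P : CotangentBundle I M) =>
      (n : ℝ)⁻¹ * ((c i)⁻¹ * (((A i).hamiltonian I).toFun P)⁻¹) ^ n) _
      fun i _ => continuousOn_const.mul ((h i).pow n)]
  simp only [h2, Finset.sum_const, Finset.card_univ, Fintype.card_fin, nsmul_eq_mul]
  ring

theorem dualMixedVolume_nonneg (hn : 1 ≤ n) (U : StarBody I M)
    (hU : (U.hamiltonian I).IsSmooth) (A : Fin n → StarBody I M) : 0 ≤ dualMixedVolume I U A := by
  rw [dualMixedVolume_eq_sphereIntegral hn U hU]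
  exact sphereIntegral_nonneg fun P _ => mul_nonneg (by positivity)
    (Finset.prod_nonneg fun i _ => inv_nonneg.2 (((A i).hamiltonian I).nonneg P))

theorem pow_dualMixedVolume_eq_of_dilations (hn : 1 ≤ n) (U : StarBody I M)
    (hU : (U.hamiltonian I).IsSmooth) (A : Fin n → StarBody I M)
    (h : ∀ i j, ∃ t : ℝ, 0 < t ∧ (A i).carrier = dilate I t (A j).carrier) :
    dualMixedVolume I U A ^ n = ∏ i, symplecticVolume I (A i).carrier := by
  let o : Fin n := ⟨0, hn⟩
  choose t ht hA using fun i => h i o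
  have hH : ∀ i P, (((A i).hamiltonian I).toFun P)⁻¹ = t i * (((A o).hamiltonian I).toFun P)⁻¹ := by
    intro i P
    rw [((A i).carrier_eq_dilate_iff (A o) (ht i)).1 (hA i) P, mul_inv, inv_inv]
  have hV : ∀ i, symplecticVolume I (A i).carrier = t i ^ n * symplecticVolume I (A o).carrier := by
    intro i
    rw [symplecticVolume_eq_sphereIntegral hn, symplecticVolume_eq_sphereIntegral hn,
      ← sphereIntegral_const_mul]
    congr 1
    funext P
    rw [hH i P]
    ring
  have hD : dualMixedVolume I U A = (∏ i, t i) * symplecticVolume I (A o).carrier := by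
    rw [dualMixedVolume_eq_sphereIntegral hn U hU, symplecticVolume_eq_sphereIntegral hn,
      ← sphereIntegral_const_mul]
    congr 1
    funext P
    rw [Finset.prod_congr rfl fun i _ => hH i P, Finset.prod_mul_distrib, Finset.prod_const,
      Finset.card_univ, Fintype.card_fin]
    ring
  rw [Finset.prod_congr rfl fun i _ => hV i, Finset.prod_mul_distrib, Finset.prod_const,
    Finset.card_univ, Fintype.card_fin, hD, mul_pow, Finset.prod_pow]

end Inequality

end StarGeom

end

theorem mainTheorem5 {n : ℕ} (hn : 1 ≤ n)
    {H : Type*} [TopologicalSpace H] (I : ModelWithCorners ℝ (EuclideanSpace ℝ (Fin n)) H)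
    {M : Type*} [TopologicalSpace M] [ChartedSpace H M] [IsManifold I ∞ M]
    [T2Space M] [CompactSpace M]
    (U : StarGeom.StarBody I M) (hU : (U.hamiltonian I).IsSmooth)
    (A : Fin n → StarGeom.StarBody I M) :
    StarGeom.dualMixedVolume I U A ^ n ≤ ∏ i, StarGeom.symplecticVolume I (A i).carrier ∧
    (StarGeom.dualMixedVolume I U A ^ n = ∏ i, StarGeom.symplecticVolume I (A i).carrier ↔
      ∀ i j, ∃ t : ℝ, 0 < t ∧ (A i).carrier = StarGeom.dilate I t (A j).carrier) := by
  rcases isEmpty_or_nonempty M with hM | hM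
  -- Over the empty manifold all volumes are zero and all bodies are equal.
  · have hn0 : n ≠ 0 := by omega
    have hV : ∀ i, StarGeom.symplecticVolume I (A i).carrier = 0 := fun i => by
      rw [StarGeom.symplecticVolume_eq_sphereIntegral hn, StarGeom.sphereIntegral_of_isEmpty]
    have h0 : StarGeom.dualMixedVolume I U A ^ n =
        ∏ i, StarGeom.symplecticVolume I (A i).carrier := by
      rw [StarGeom.dualMixedVolume_eq_sphereIntegral hn U hU, StarGeom.sphereIntegral_of_isEmpty,
        zero_pow hn0]
      exact (Finset.prod_eq_zero (Finset.mem_univ ⟨0, hn⟩) (hV _)).symm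
    refine ⟨h0.le, fun _ i j => ⟨1, one_pos, ?_⟩, fun _ => h0⟩
    ext P
    exact hM.elim P.proj
  have hn0 : n ≠ 0 := by omega
  have hnR : (0 : ℝ) < n := by exact_mod_cast hn
  let V : Fin n → ℝ := fun i => StarGeom.symplecticVolume I (A i).carrier
  have hV : ∀ i, 0 < V i := fun i => StarGeom.symplecticVolume_pos hn (A i)
  let c : Fin n → ℝ := fun i => V i ^ ((n : ℝ)⁻¹)
  have hc : ∀ i, 0 < c i := fun i => Real.rpow_pos_of_pos (hV i) _
  have hcV : ∀ i, c i ^ n = V i := fun i => Real.rpow_inv_natCast_pow (hV i).le hn0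
  have hcp : 0 < ∏ i, c i := Finset.prod_pos fun i _ => hc i
  have hpow : ∏ i, V i = (∏ i, c i) ^ n := by
    rw [← Finset.prod_pow]
    exact Finset.prod_congr rfl fun i _ => (hcV i).symm
  have hD := StarGeom.dualMixedVolume_nonneg hn U hU A
  have hdef := StarGeom.sphereIntegral_meanDeficit hn U hU A hc hcV
  have hdef0 := StarGeom.sphereIntegral_nonneg (I := I) (M := M) fun P _ =>
    StarGeom.meanDeficit_nonneg hn A hc P
  have hle : StarGeom.dualMixedVolume I U A ≤ ∏ i, c i := by
    rw [hdef] at hdef0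
    have h1 := nonneg_of_mul_nonneg_right hdef0 hnR
    rwa [sub_nonneg, inv_mul_le_iff₀ hcp, mul_one] at h1
  refine ⟨(pow_le_pow_left₀ hD hle n).trans_eq hpow.symm, fun heq i j => ?_,
    StarGeom.pow_dualMixedVolume_eq_of_dilations hn U hU A⟩
  have heq' : StarGeom.dualMixedVolume I U A = ∏ i, c i :=
    (pow_left_inj₀ hD hcp.le hn0).1 (heq.trans hpow)
  rw [heq', inv_mul_cancel₀ hcp.ne', sub_self, mul_zero] at hdef
  refine ⟨c i / c j, div_pos (hc i) (hc j), ?_⟩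
  rw [StarGeom.StarBody.carrier_eq_dilate_iff _ _ (div_pos (hc i) (hc j))]
  intro P
  by_cases hP : P.snd = 0
  · rw [StarGeom.StarHamiltonian.eq_zero_of_snd_eq_zero _ hP,
      StarGeom.StarHamiltonian.eq_zero_of_snd_eq_zero _ hP, mul_zero]
  obtain ⟨r, hr, h0⟩ := StarGeom.exists_scale_eq_zero_of_sphereIntegral_eq_zero
    (StarGeom.continuousOn_meanDeficit A c) (fun P _ => StarGeom.meanDeficit_nonneg hn A hc P)
    hdef P hP
  have h1 := StarGeom.eq_of_prod_eq_sum_inv_mul_pow hn _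
    (fun i => mul_nonneg (inv_pos.2 (hc i)).le
      (inv_nonneg.2 (((A i).hamiltonian I).nonneg (StarGeom.scale I r P))))
    (sub_eq_zero.1 h0).symm i j
  simp only [StarGeom.StarHamiltonian.homogeneous _ r P hr] at h1
  have hi := ((A i).hamiltonian I).pos P hP
  have hj := ((A j).hamiltonian I).pos P hP
  have hci := hc i
  have hcj := hc j
  field_simp at h1 ⊢
  linarith
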